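/- Let $+$ and $\times$ be ternary relation symbols. For $N\in\mathbb N$ let $\langle\underline N,+,\times\rangle$ be the relational structure with universe $\underline N=\{0,\dots,N\}$ in which $+(a,b,c)$ holds iff $a+b=c$ and $\times(a,b,c)$ holds iff $a\cdot b=c$. For a first-order formula (with equality) $\Phi(x_1,\dots,x_n)$ over these symbols, where $n\ge 0$, put $$\mathcal L_\Phi=\{(N,x_1,\dots,x_n)\in\mathbb N^{n+1} : x_1,\dots,x_n\le N \text{ and } \langle\underline N,+,\times\rangle\models\Phi(x_1,\dots,x_n)\}.$$ A counter program with counters $1,\dots,d$ ranging over $\mathbb N$ is a finite sequence of lines $1,\dots,m$. The last line is $\mathbf{halt}$, and every other line carries one of the instructions $x\mathrel{+}=c$, $x\mathrel{-}=c$ (with $c\in\mathbb N$; the decrement blocks if $x<c$), $\mathbf{goto}\ L_1\ \mathbf{or}\ L_2$ (a non-deterministic jump to line $L_1$ or $L_2$, where $1\le L_1,L_2\le m$), or $\mathbf{skip}$; after an instruction that is not a jump the next line is executed. For a counter program $C$ let $\mathcal L_C\subseteq\mathbb N^d$ be the set of initial counter values from which $C$ has a zero-terminating run, that is, a run that starts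 on line $1$ and ends on the line $\mathbf{halt}$ with all counters equal to $0$. A $d$-dimensional VASS $A$ consists of a finite set $Q$ of states, a finite set of transitions in $Q\times\mathbb Z^d\times Q$, an initial state $q_0$, and a final state $q_f$ without outgoing transitions; a transition $(q,z,r)$ leads from a configuration $(q,f)\in Q\times\mathbb N^d$ to $(r,f+z)$ provided that $f+z\in\mathbb N^d$. Let $\mathcal L_A\subseteq\mathbb N^d$ be the set of all $x$ such that $A$ has a run from $(q_0,x)$ to $(q_f,0)$. A set $L\subseteq\mathbb N^k$ arithmetically reduces to $M\subseteq\mathbb N^\ell$ if there are polynomials $p_1,\dots,p_\ell$ in $k$ variables with coefficients in $\mathbb N$ such that for all $m\in\mathbb N^k$: $m\in L$ if and only if $(p_1(m),\dots,p_\ell(m))\in M$. **Theorem.** For every first-order formula $\Phi(x_1,\dots,x_n)$ over $+$ and $\times$ there is a counter program $C$ with at least one counter such that $\mathcal L_\Phi$ arithmetically reduces to $\mathcal L_C$, and likewise there is a VASS $A$ of dimension at least one such that $\mathcal L_\Phi$ arithmetically reduces to $\mathcal L_A$. Consequently, there are VASS $A$ and $A'$ of dimension at least one such that the set of prime numbers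 arithmetically reduces to $\mathcal L_A$ and the set of square-free natural numbers arithmetically reduces to $\mathcal L_{A'}$ (as subsets of $\mathbb N=\mathbb N^1$). -/

import Mathlib

namespace FixedVASS

/-! ### Rudimentary arithmetic -/

/-- Two ternary relation symbols, for the graphs of addition and of multiplication. -/
inductive ArithRel : ℕ → Type
  | add : ArithRel 3
  | mul : ArithRel 3

/-- The purely relational language of `FO(+,×)`: no function symbols and no constants.
Equality is the logical equality of first-order formulas. -/
def arith : FirstOrder.Language where
  Functions := fun _ => Empty
  Relations := ArithRel

/-- The initial segment `{0, …, N}` of the natural numbers. -/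
abbrev Segment (N : ℕ) : Type := {m : ℕ // m ≤ N}

/-- The relational structure `⟨{0, …, N}, +, ×⟩`: the symbols hold of `(a, b, c)` when
`a + b = c`, respectively `a * b = c`, in the natural numbers. -/
instance segmentStructure (N : ℕ) : arith.Structure (Segment N) where
  funMap := fun {_} s _ => Empty.elim s
  RelMap := fun {_} R =>
    match R with
    | ArithRel.add => fun v => (v 0 : ℕ) + (v 1 : ℕ) = (v 2 : ℕ)
    | ArithRel.mul => fun v => (v 0 : ℕ) * (v 1 : ℕ) = (v 2 : ℕ)

/-- The yes-instances `(N, x₁, …, xₙ)` of the validity problem of a fixed formula `Φ(x₁, …, xₙ)`: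
all `xᵢ` lie in `{0, …, N}` and `⟨{0, …, N}, +, ×⟩ ⊨ Φ(x₁, …, xₙ)`. Coordinate `0` is `N`. -/
def formulaLanguage {n : ℕ} (Φ : arith.Formula (Fin n)) : Set (Fin (n + 1) → ℕ) :=
  {v | ∃ h : ∀ i : Fin n, v i.succ ≤ v 0,
    Φ.Realize (fun i : Fin n => (⟨v i.succ, h i⟩ : Segment (v 0)))}

/-! ### Counter programs -/

/-- Instructions of a counter program over the counters `Fin d`. -/
inductive Instr (d : ℕ) : Type
  | inc (x : Fin d) (c : ℕ)
  | dec (x : Fin d) (c : ℕ)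
  | goto (L₁ L₂ : ℕ)
  | skip

/-- All jump targets of the instruction are among the lines `1, …, m`. -/
def Instr.TargetsIn {d : ℕ} (m : ℕ) : Instr d → Prop
  | .goto L₁ L₂ => (1 ≤ L₁ ∧ L₁ ≤ m) ∧ (1 ≤ L₂ ∧ L₂ ≤ m)
  | _ => True

/-- Executing the instruction on line `L` with valuation `f` may lead to line `L'` with
valuation `f'`. A decrement that would make the counter negative blocks. -/
def Instr.Step {d : ℕ} (L : ℕ) (f : Fin d → ℕ) (L' : ℕ) (f' : Fin d → ℕ) : Instr d → Prop
  | .inc x c => L' = L + 1 ∧ f' = Function.update f x (f x + c)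
  | .dec x c => c ≤ f x ∧ L' = L + 1 ∧ f' = Function.update f x (f x - c)
  | .goto L₁ L₂ => (L' = L₁ ∨ L' = L₂) ∧ f' = f
  | .skip => L' = L + 1 ∧ f' = f

/-- A counter program with counters `Fin d`. Its lines are `1, …, code.length + 1`; line `k + 1`
carries the instruction `code[k]`, and the last line, `code.length + 1`, is `halt`. -/
structure CounterProgram (d : ℕ) where
  code : List (Instr d)
  targets : ∀ i ∈ code, i.TargetsIn (code.length + 1)

namespace CounterProgram

variable {d : ℕ}

/-- The number of the line that carries `halt`. -/
def haltLine (C : CounterProgram d) : ℕ := C.code.length + 1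

/-- One step between configurations (line, counter valuation). There is none from `halt`. -/
def Step (C : CounterProgram d) (a b : ℕ × (Fin d → ℕ)) : Prop :=
  ∃ (k : ℕ) (i : Instr d), a.1 = k + 1 ∧ C.code[k]? = some i ∧ i.Step a.1 a.2 b.1 b.2

/-- The initial valuations from which there is a zero-terminating run: a run that starts on
line `1` and ends on `halt` with all counters zero. -/
def language (C : CounterProgram d) : Set (Fin d → ℕ) :=
  {x | Relation.ReflTransGen C.Step (1, x) (C.haltLine, 0)}

end CounterProgram

/-! ### Vector addition systems with states -/

/-- A `d`-dimensional vector addition system with states, with initial state `init` and final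
state `final`; the final state has no outgoing transitions. -/
structure VASS (d : ℕ) where
  State : Type
  finite_state : Finite State
  trans : Set (State × (Fin d → ℤ) × State)
  finite_trans : trans.Finite
  init : State
  final : State
  final_no_out : ∀ z r, (final, z, r) ∉ trans

namespace VASS

variable {d : ℕ}

/-- One step between configurations: the counters stay non-negative because they are in `ℕ`. -/
def Step (A : VASS d) (a b : A.State × (Fin d → ℕ)) : Prop :=
  ∃ z : Fin d → ℤ, (a.1, z, b.1) ∈ A.trans ∧ ∀ j, (b.2 j : ℤ) = (a.2 j : ℤ) + z j

/-- The source vectors `x` such that there is a run from `(init, x)` to `(final, 0)`. -/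
def language (A : VASS d) : Set (Fin d → ℕ) :=
  {x | Relation.ReflTransGen A.Step (A.init, x) (A.final, 0)}

end VASS

/-! ### Arithmetic reductions -/

/-- `L ⊆ ℕ^k` arithmetically reduces to `M ⊆ ℕ^l`: there are fixed polynomials
`p₁, …, p_l : ℕ^k → ℕ` (with natural coefficients) such that `m ∈ L` iff
`(p₁(m), …, p_l(m)) ∈ M`, for every `m ∈ ℕ^k`. -/
def ArithReduces {k l : ℕ} (L : Set (Fin k → ℕ)) (M : Set (Fin l → ℕ)) : Prop :=
  ∃ p : Fin l → MvPolynomial (Fin k) ℕ,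
    ∀ m : Fin k → ℕ, m ∈ L ↔ (fun i => MvPolynomial.eval m (p i)) ∈ M

end FixedVASS

/-! The formula is evaluated over `{0, …, N}` by a non-deterministic program with zero tests. A
bound variable is a pair of counters with sum `N`, connectives become sequencing and choice, and a
universal quantifier becomes a loop through all values. A true formula has an accepting evaluation
in which the number of zero tests and the size of all variables are bounded by polynomials in `N`
(`guarded`).

The reduction supplies these polynomials as initial counter values, which makes it possible to
remove the zero tests. Let `B` bound the variables and let `K` bound the number of tests. Each
variable `x` gets a complement `B - x`; two further counters start at `cnt = K` and `prod = 2 * B *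
K`. A test of `x` moves units from the complement to `x` and back, takes every moved unit from
`prod`, and takes `1` from `cnt`. At most `2 * B` units can be moved, and exactly `2 * B` only if `x
= 0`. So `prod - 2 * B * cnt` never decreases; it is `0` at the start and `0` when all counters
vanish, hence every test in a zero-terminating run is honest (`Prog.sim_sound`). Conversely, an
honest run with at most `K` tests can be completed by idle tests of a variable that is `0`
(`arithReduces_of_program`).

Structured programs compile to counter programs (`Prog.mem_language_compile`), and these are VASS
whose states are the lines (`CounterProgram.language_toVASS`). Primality and square-freeness of `m`
are expressed by formulas over `{0, …, m}` with input `m`. -/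

namespace FixedVASS

/-! ### Structured non-deterministic programs -/

/-- Regular programs over the atomic actions `α`. -/
inductive Prog (α : Type) : Type
  | skip : Prog α
  | atom (a : α) : Prog α
  | seq (P Q : Prog α) : Prog α
  | choice (P Q : Prog α) : Prog α
  | star (P : Prog α) : Prog α

/-- Big-step semantics of regular programs. -/
inductive Run {α S : Type} (step : α → S → S → Prop) : Prog α → S → S → Prop
  | skip (s : S) : Run step .skip s s
  | atom {a : α} {s t : S} : step a s t → Run step (.atom a) s t
  | seq {P Q : Prog α} {s t u : S} : Run step P s t → Run step Q t u → Run step (.seq P Q) s u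
  | left {P Q : Prog α} {s t : S} : Run step P s t → Run step (.choice P Q) s t
  | right {P Q : Prog α} {s t : S} : Run step Q s t → Run step (.choice P Q) s t
  | nil {P : Prog α} (s : S) : Run step (.star P) s s
  | cons {P : Prog α} {s t u : S} :
      Run step P s t → Run step (.star P) t u → Run step (.star P) s u

section Run

variable {α S : Type} {step : α → S → S → Prop} {P Q : Prog α} {s t : S}

theorem run_skip : Run step .skip s t ↔ t = s :=
  ⟨fun h => by cases h; rfl, fun h => by subst h; exact .skip _⟩

theorem run_atom {a : α} : Run step (.atom a) s t ↔ step a s t :=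
  ⟨fun h => by cases h; assumption, .atom⟩

theorem run_seq : Run step (.seq P Q) s t ↔ ∃ u, Run step P s u ∧ Run step Q u t :=
  ⟨fun h => by cases h; exact ⟨_, ‹_›, ‹_›⟩, fun ⟨_, h, h'⟩ => .seq h h'⟩

theorem run_choice : Run step (.choice P Q) s t ↔ Run step P s t ∨ Run step Q s t :=
  ⟨fun h => by
    cases h
    · exact .inl ‹_›
    · exact .inr ‹_›, fun h => h.elim .left .right⟩

/-- Invariant rule for iteration. -/
theorem Run.star_induction (I : S → Prop) (hI : ∀ s t, I s → Run step P s t → I t)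
    (h : Run step (.star P) s t) (hs : I s) : I t := by
  generalize hR : Prog.star P = R at h
  induction h with
  | nil => exact hs
  | cons h₁ h₂ _ ih₂ =>
    cases hR
    exact ih₂ (hI _ _ hs h₁) rfl
  | _ => cases hR

/-- Chains of runs of the body are runs of the iteration. -/
theorem Run.star_of_chain (c : ℕ → S) (m : ℕ) (h : ∀ j < m, Run step P (c j) (c (j + 1))) :
    Run step (.star P) (c 0) (c m) := by
  induction m generalizing c with
  | zero => exact .nil _
  | succ m ih =>
    exact .cons (h 0 (by omega)) (ih (fun j => c (j + 1)) fun j hj => h (j + 1) (by omega))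

end Run

/-! ### Compilation to counter programs -/

/-- Unit increments and decrements of the counters `σ`. -/
inductive Op (σ : Type) : Type
  | inc (x : σ) : Op σ
  | dec (x : σ) : Op σ

/-- Semantics of the unit operations. -/
def Op.step {σ : Type} [DecidableEq σ] : Op σ → (σ → ℕ) → (σ → ℕ) → Prop
  | .inc x => fun f f' => f' = Function.update f x (f x + 1)
  | .dec x => fun f f' => 0 < f x ∧ f' = Function.update f x (f x - 1)

/-- The instruction that carries out a unit operation. -/
def Op.instr {σ : Type} {d : ℕ} (e : σ ≃ Fin d) : Op σ → Instr d
  | .inc x => .inc (e x) 1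
  | .dec x => .dec (e x) 1

/-- The number of instructions of the compiled program. -/
def Prog.size {α : Type} : Prog α → ℕ
  | .skip => 0
  | .atom _ => 1
  | .seq P Q => P.size + Q.size
  | .choice P Q => P.size + Q.size + 2
  | .star P => P.size + 2

/-- The instructions of the compiled program, to be placed after `o` other instructions. -/
def Prog.code {σ : Type} {d : ℕ} (e : σ ≃ Fin d) : Prog (Op σ) → ℕ → List (Instr d)
  | .skip, _ => []
  | .atom a, _ => [a.instr e]
  | .seq P Q, o => P.code e o ++ Q.code e (o + P.size)
  -- The instruction after `o` others sits on line `o + 1`, and control leaves each block at line `o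
  -- + size + 1`. Here the two branches start on lines `o + 2` and `o + P.size + 3`.
  | .choice P Q, o => .goto (o + 2) (o + P.size + 3) :: (P.code e (o + 1) ++
      .goto (o + P.size + Q.size + 3) (o + P.size + Q.size + 3) :: Q.code e (o + P.size + 2))
  | .star P, o => .goto (o + 2) (o + P.size + 3) :: (P.code e (o + 1) ++
      [.goto (o + 1) (o + 1)])

section Compile

variable {σ : Type} {d : ℕ} (e : σ ≃ Fin d)

theorem Prog.length_code (P : Prog (Op σ)) (o : ℕ) : (P.code e o).length = P.size := by
  induction P generalizing o with
  | skip => rfl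
  | atom a => rfl
  | seq P Q hP hQ => simp [code, size, hP, hQ]
  | choice P Q hP hQ => simp [code, size, hP, hQ]; omega
  | star P hP => simp [code, size, hP]

theorem Prog.targetsIn_code (P : Prog (Op σ)) (o m : ℕ) (hm : o + P.size + 1 ≤ m) :
    ∀ i ∈ P.code e o, i.TargetsIn m := by
  induction P generalizing o with
  | skip => simp [code]
  | atom a => cases a <;> simp [code, Op.instr, Instr.TargetsIn]
  | seq P Q hP hQ =>
    simp only [size] at hm
    intro i hi
    rcases List.mem_append.1 hi with hi | hi
    · exact hP _ (by omega) i hi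
    · exact hQ _ (by omega) i hi
  | choice P Q hP hQ =>
    simp only [size] at hm
    intro i hi
    simp only [code, List.mem_cons, List.mem_append] at hi
    rcases hi with rfl | hi | rfl | hi
    · simp only [Instr.TargetsIn]; omega
    · exact hP _ (by omega) i hi
    · simp only [Instr.TargetsIn]; omega
    · exact hQ _ (by omega) i hi
  | star P hP =>
    simp only [size] at hm
    intro i hi
    simp only [code, List.mem_cons, List.mem_append, List.not_mem_nil, or_false] at hi
    rcases hi with rfl | hi | rfl
    · simp only [Instr.TargetsIn]; omega
    · exact hP _ (by omega) i hi
    · simp only [Instr.TargetsIn]; omega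

namespace CounterProgram

/-- The instructions `l` occur in `C` after `o` other instructions. -/
def Has (C : CounterProgram d) (o : ℕ) (l : List (Instr d)) : Prop :=
  ∀ k i, l[k]? = some i → C.code[o + k]? = some i

variable {C : CounterProgram d}

theorem has_cons {o : ℕ} {i : Instr d} {l : List (Instr d)} :
    C.Has o (i :: l) ↔ C.code[o]? = some i ∧ C.Has (o + 1) l := by
  constructor
  · intro h
    refine ⟨h 0 i rfl, fun k j hj => ?_⟩
    have := h (k + 1) j (by simpa using hj)
    rwa [show o + 1 + k = o + (k + 1) by ring]
  · rintro ⟨h, h'⟩ (_ | k) j hj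
    · simp only [List.getElem?_cons_zero, Option.some.injEq] at hj
      exact hj ▸ h
    · have := h' k j (by simpa using hj)
      rwa [show o + 1 + k = o + (k + 1) by ring] at this

theorem has_append {o : ℕ} {l l' : List (Instr d)} :
    C.Has o (l ++ l') ↔ C.Has o l ∧ C.Has (o + l.length) l' := by
  induction l generalizing o with
  | nil => simp [Has]
  | cons i l ih =>
    simp only [List.cons_append, has_cons, ih, List.length_cons, and_assoc,
      show o + 1 + l.length = o + (l.length + 1) by ring]

theorem step_iff {o : ℕ} {i : Instr d} (h : C.code[o]? = some i) {f : Fin d → ℕ}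
    {b : ℕ × (Fin d → ℕ)} : C.Step (o + 1, f) b ↔ i.Step (o + 1) f b.1 b.2 := by
  constructor
  · rintro ⟨k, j, hk, hj, hs⟩
    obtain rfl : o = k := by simpa using hk
    obtain rfl : i = j := by simpa [h] using hj
    exact hs
  · exact fun hs => ⟨o, i, rfl, h, hs⟩

theorem goto_step {o L₁ L₂ : ℕ} (h : C.code[o]? = some (.goto L₁ L₂)) {f : Fin d → ℕ}
    {b : ℕ × (Fin d → ℕ)} : C.Step (o + 1, f) b ↔ b = (L₁, f) ∨ b = (L₂, f) := by
  rw [step_iff h]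
  obtain ⟨l, f'⟩ := b
  simp only [Instr.Step, Prod.mk.injEq]
  tauto

variable [DecidableEq σ]

theorem op_step {o : ℕ} {a : Op σ} (h : C.code[o]? = some (a.instr e)) {f : σ → ℕ}
    {b : ℕ × (Fin d → ℕ)} :
    C.Step (o + 1, f ∘ e.symm) b ↔ ∃ f', b = (o + 2, f' ∘ e.symm) ∧ a.step f f' := by
  rw [step_iff h]
  obtain ⟨l, f'⟩ := b
  have key : ∀ (x : σ) (v : ℕ), Function.update (f ∘ e.symm) (e x) v
      = Function.update f x v ∘ e.symm := by
    intro x v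
    funext j
    by_cases hj : j = e x
    · simp [hj]
    · have : e.symm j ≠ x := fun h => hj (by simp [← h])
      simp [hj, this]
  cases a <;> simp [Op.instr, Instr.Step, Op.step, key, Nat.succ_le_iff]
  tauto

theorem reach_of_run {P : Prog (Op σ)} {f f' : σ → ℕ} (h : Run Op.step P f f') :
    ∀ o, C.Has o (P.code e o) → Relation.ReflTransGen C.Step
      (o + 1, f ∘ e.symm) (o + P.size + 1, f' ∘ e.symm) := by
  induction h with
  | skip f => exact fun o _ => .refl
  | atom h =>
    intro o ho
    exact .single ((op_step e (has_cons.1 ho).1).2 ⟨_, rfl, h⟩)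
  | @seq P Q _ _ _ _ _ ihP ihQ =>
    intro o ho
    have h := has_append.1 ho
    rw [Prog.length_code] at h
    have := (ihP o h.1).trans (ihQ _ h.2)
    rwa [Prog.size, ← add_assoc]
  | @left P Q _ _ _ ih =>
    intro o ho
    simp only [Prog.code, has_cons, has_append, Prog.length_code] at ho
    obtain ⟨h₀, h₁, h₂, -⟩ := ho
    have h₃ := ih _ h₁
    rw [show o + 1 + P.size + 1 = (o + 1 + P.size) + 1 by ring] at h₃
    refine .head ((goto_step h₀).2 (.inl rfl)) (h₃.trans (.single ((goto_step h₂).2 (.inl ?_))))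
    simp only [Prog.size]
    congr 1
    omega
  | @right P Q _ _ _ ih =>
    intro o ho
    simp only [Prog.code, has_cons, has_append, Prog.length_code] at ho
    obtain ⟨h₀, -, -, h₃⟩ := ho
    rw [show o + 1 + P.size + 1 = o + P.size + 2 by ring] at h₃
    have h₄ := ih _ h₃
    refine .head ((goto_step h₀).2 (.inr rfl)) ?_
    convert h₄ using 2
    simp only [Prog.size]
    omega
  | @nil P _ =>
    intro o ho
    simp only [Prog.code, has_cons, has_append, Prog.length_code] at ho
    exact .single ((goto_step ho.1).2 (.inr rfl))
  | @cons P _ _ _ _ _ ihP ihS =>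
    intro o ho
    have hs := ihS o ho
    simp only [Prog.code, has_cons, has_append, Prog.length_code] at ho
    obtain ⟨h₀, h₁, h₂, -⟩ := ho
    exact .head ((goto_step h₀).2 (.inl rfl)) ((ihP _ h₁).trans
      (.head ((goto_step h₂).2 (.inl rfl)) hs))

/-- `C` has a zero-terminating run with `n` steps from line `l` and valuation `f`. -/
def Terminates (C : CounterProgram d) : ℕ → ℕ → (Fin d → ℕ) → Prop
  | 0, l, f => l = C.haltLine ∧ f = 0
  | n + 1, l, f => ∃ b, C.Step (l, f) b ∧ C.Terminates n b.1 b.2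

theorem exists_terminates {a : ℕ × (Fin d → ℕ)}
    (h : Relation.ReflTransGen C.Step a (C.haltLine, 0)) : ∃ n, C.Terminates n a.1 a.2 := by
  induction h using Relation.ReflTransGen.head_induction_on with
  | refl => exact ⟨0, rfl, rfl⟩
  | head h _ ih =>
    obtain ⟨n, hn⟩ := ih
    exact ⟨n + 1, _, h, hn⟩

theorem Terminates.exists_step {n o : ℕ} {i : Instr d} {f : Fin d → ℕ}
    (h : C.Terminates n (o + 1) f) (hi : C.code[o]? = some i) :
    ∃ m b, n = m + 1 ∧ C.Step (o + 1, f) b ∧ C.Terminates m b.1 b.2 := by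
  cases n with
  | zero =>
    have h₁ : o + 1 = C.code.length + 1 := h.1
    have h₂ := (List.getElem?_eq_some_iff.1 hi).1
    omega
  | succ m =>
    obtain ⟨b, hb, hm⟩ := h
    exact ⟨m, b, rfl, hb, hm⟩

/-- Structural induction alone does not handle `star`, whose code jumps back to its own beginning.
The length of the remaining run is therefore tracked, and the `star` case uses strong induction on
it. -/
theorem run_of_terminates (P : Prog (Op σ)) (n o : ℕ) (f : σ → ℕ) (ho : C.Has o (P.code e o))
    (h : C.Terminates n (o + 1) (f ∘ e.symm)) :
    ∃ m f', m ≤ n ∧ Run Op.step P f f' ∧ C.Terminates m (o + P.size + 1) (f' ∘ e.symm) := by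
  induction P generalizing n o f with
  | skip => exact ⟨n, f, le_rfl, .skip f, h⟩
  | atom a =>
    have hc := (has_cons.1 ho).1
    obtain ⟨m, b, rfl, hb, hm⟩ := h.exists_step hc
    obtain ⟨f', rfl, hs⟩ := (op_step e hc).1 hb
    exact ⟨m, f', by omega, .atom hs, hm⟩
  | seq P Q ihP ihQ =>
    have h' := has_append.1 ho
    rw [Prog.length_code] at h'
    obtain ⟨m, f₁, hm, h₁, h₂⟩ := ihP _ _ _ h'.1 h
    obtain ⟨m', f₂, hm', h₃, h₄⟩ := ihQ _ _ _ h'.2 h₂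
    exact ⟨m', f₂, by omega, .seq h₁ h₃, by rwa [Prog.size, ← add_assoc]⟩
  | choice P Q ihP ihQ =>
    simp only [Prog.code, has_cons, has_append, Prog.length_code] at ho
    obtain ⟨h₀, h₁, h₂, h₃⟩ := ho
    rw [show o + 1 + P.size + 1 = o + P.size + 2 by ring] at h₃
    obtain ⟨m, b, rfl, hb, hm⟩ := h.exists_step h₀
    rcases (goto_step h₀).1 hb with rfl | rfl
    · obtain ⟨m₁, f₁, hm₁, h₄, h₅⟩ := ihP _ _ _ h₁ hm
      obtain ⟨m₂, b, rfl, hb₂, hm₂⟩ := h₅.exists_step h₂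
      have hb' := (goto_step h₂).1 hb₂
      rw [or_self] at hb'
      subst hb'
      refine ⟨m₂, f₁, by omega, .left h₄, ?_⟩
      convert hm₂ using 1
      simp only [Prog.size]
      omega
    · obtain ⟨m₁, f₁, hm₁, h₄, h₅⟩ := ihQ _ _ _ h₃ hm
      refine ⟨m₁, f₁, by omega, .right h₄, ?_⟩
      convert h₅ using 1
      simp only [Prog.size]
      omega
  | star P ihP =>
    have hc := ho
    simp only [Prog.code, has_cons, has_append, Prog.length_code] at hc
    obtain ⟨h₀, h₁, h₂, -⟩ := hc
    induction n using Nat.strong_induction_on generalizing f with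
    | _ n ihn =>
    obtain ⟨m, b, rfl, hb, hm⟩ := h.exists_step h₀
    rcases (goto_step h₀).1 hb with rfl | rfl
    · obtain ⟨m₁, f₁, hm₁, h₄, h₅⟩ := ihP _ _ _ h₁ hm
      obtain ⟨m₂, b, rfl, hb₂, hm₂⟩ := h₅.exists_step h₂
      have hb' := (goto_step h₂).1 hb₂
      rw [or_self] at hb'
      subst hb'
      obtain ⟨m₃, f₃, hm₃, h₆, h₇⟩ := ihn m₂ (by omega) f₁ hm₂
      exact ⟨m₃, f₃, by omega, .cons h₄ h₆, h₇⟩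
    · exact ⟨m, f, by omega, .nil f, hm⟩

end CounterProgram

/-- The counter program that a structured program compiles to. -/
def Prog.compile (e : σ ≃ Fin d) (P : Prog (Op σ)) : CounterProgram d where
  code := P.code e 0
  targets := P.targetsIn_code e 0 _ (by rw [P.length_code e]; omega)

theorem Prog.mem_language_compile [DecidableEq σ] (P : Prog (Op σ)) (f : σ → ℕ) :
    f ∘ e.symm ∈ (P.compile e).language ↔ Run Op.step P f 0 := by
  have hh : (P.compile e).Has 0 (P.code e 0) := fun k i h => by rwa [zero_add]
  have hl : (P.compile e).haltLine = 0 + P.size + 1 := by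
    simp [CounterProgram.haltLine, compile, P.length_code e]
  constructor
  · intro h
    obtain ⟨n, hn⟩ := CounterProgram.exists_terminates h
    obtain ⟨m, f', -, hr, hm⟩ := CounterProgram.run_of_terminates e P n 0 f hh hn
    -- The compiled block is the whole program, so its exit line is `halt`, from which no further
    -- step is possible.
    cases m with
    | zero =>
      have : f' = 0 := by
        funext x
        simpa using congrFun hm.2 (e x)
      exact this ▸ hr
    | succ m =>
      obtain ⟨b, ⟨k, i, hk, hi, -⟩, -⟩ := hm
      have h₁ : 0 + P.size + 1 = k + 1 := hk
      have h₂ := (List.getElem?_eq_some_iff.1 hi).1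
      have h₃ : (P.compile e).code.length = P.size := P.length_code e 0
      omega
  · intro h
    have := CounterProgram.reach_of_run e h 0 hh
    rw [← hl] at this
    exact this

end Compile

/-! ### Counter programs as vector addition systems -/

/-- The effect of an instruction on the counters. -/
def Instr.effect {d : ℕ} : Instr d → Fin d → ℤ
  | .inc x c => Pi.single x (c : ℤ)
  | .dec x c => Pi.single x (-(c : ℤ))
  | _ => 0

/-- The instruction on line `l` may be followed by line `l'`. -/
def Instr.Succ {d : ℕ} (l l' : ℕ) : Instr d → Prop
  | .goto L₁ L₂ => l' = L₁ ∨ l' = L₂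
  | _ => l' = l + 1

/-- The blocking condition of a decrement needs no separate clause: it follows from the integer
equation because `f'` takes values in `ℕ`. -/
theorem Instr.step_iff_effect {d : ℕ} (i : Instr d) (l l' : ℕ) (f f' : Fin d → ℕ) :
    i.Step l f l' f' ↔ i.Succ l l' ∧ ∀ j, (f' j : ℤ) = f j + i.effect j := by
  have hz : f' = f ↔ ∀ j, (f' j : ℤ) = f j := by simp [funext_iff]
  cases i with
  | inc x c =>
    simp only [Step, Succ, effect, funext_iff]
    refine and_congr_right fun _ => forall_congr' fun j => ?_
    by_cases hj : j = x
    · subst hj; simp; omega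
    · simp [hj]
  | dec x c =>
    simp only [Step, Succ, effect, funext_iff]
    constructor
    · rintro ⟨hc, hl, h⟩
      refine ⟨hl, fun j => ?_⟩
      rw [h j]
      by_cases hj : j = x
      · subst hj; simp; omega
      · simp [hj]
    · rintro ⟨hl, h⟩
      have hx := h x
      simp only [Pi.single_eq_same] at hx
      refine ⟨by omega, hl, fun j => ?_⟩
      have := h j
      by_cases hj : j = x
      · subst hj; simp; omega
      · simp [hj] at this; simp [hj, this]
  | goto L₁ L₂ => simp [Step, Succ, effect, hz]
  | skip => simp [Step, Succ, effect, hz]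

/-- The vector addition system of a counter program; its states are the lines. -/
def CounterProgram.toVASS {d : ℕ} (C : CounterProgram d) : VASS d where
  State := Fin (C.haltLine + 1)
  finite_state := inferInstance
  trans := {t | ∃ (k : ℕ) (i : Instr d), (t.1 : ℕ) = k + 1 ∧ C.code[k]? = some i ∧
    t.2.1 = i.effect ∧ i.Succ t.1 t.2.2}
  finite_trans := by
    -- A transition is determined by its two end lines, since its vector is the effect of the
    -- instruction on the source line; the `- 1` turns a line number into a list index.
    refine (Set.finite_range (fun p : Fin (C.haltLine + 1) × Fin (C.haltLine + 1) =>
      (p.1, ((C.code[(p.1 : ℕ) - 1]?).elim 0 Instr.effect, p.2)))).subset ?_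
    rintro ⟨q, z, r⟩ ⟨k, i, hk, hi, hz, -⟩
    refine ⟨(q, r), ?_⟩
    simp only at hk hz
    simp [hk, hi, hz]
  init := ⟨1, by simp [haltLine]⟩
  final := ⟨C.haltLine, by omega⟩
  final_no_out := by
    rintro z r ⟨k, i, hk, hi, -⟩
    have h₁ : C.code.length + 1 = k + 1 := hk
    have h₂ := (List.getElem?_eq_some_iff.1 hi).1
    omega

theorem CounterProgram.step_toVASS {d : ℕ} (C : CounterProgram d)
    (a b : Fin (C.haltLine + 1) × (Fin d → ℕ)) :
    C.toVASS.Step a b ↔ C.Step (a.1, a.2) (b.1, b.2) := by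
  constructor
  · rintro ⟨z, ⟨k, i, hk, hi, hz, hs⟩, h⟩
    simp only at hz hs hk
    subst hz
    exact ⟨k, i, hk, hi, (i.step_iff_effect _ _ _ _).2 ⟨hs, h⟩⟩
  · rintro ⟨k, i, hk, hi, hs⟩
    have := (i.step_iff_effect _ _ _ _).1 hs
    exact ⟨i.effect, ⟨k, i, hk, hi, rfl, this.1⟩, this.2⟩

/-- Guarantees that every line that is reached is a state of `toVASS`; this is where the condition
on jump targets enters. -/
theorem CounterProgram.line_le {d : ℕ} (C : CounterProgram d) {a b : ℕ × (Fin d → ℕ)}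
    (h : C.Step a b) : b.1 ≤ C.haltLine := by
  obtain ⟨k, i, hk, hi, hs⟩ := h
  have h₂ := (List.getElem?_eq_some_iff.1 hi).1
  have ht := C.targets i (List.mem_of_getElem? hi)
  have h₃ : C.haltLine = C.code.length + 1 := rfl
  cases i <;> simp only [Instr.Step, Instr.TargetsIn] at hs ht <;> omega

theorem CounterProgram.language_toVASS {d : ℕ} (C : CounterProgram d) :
    C.toVASS.language = C.language := by
  ext x
  constructor
  · intro h
    exact Relation.ReflTransGen.lift (r := C.toVASS.Step) (p := C.Step)
      (fun a : Fin (C.haltLine + 1) × (Fin d → ℕ) => ((a.1 : ℕ), a.2))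
      (fun a b hab => (C.step_toVASS a b).1 hab) _ _ h
  · intro h
    have key : ∀ a : ℕ × (Fin d → ℕ), Relation.ReflTransGen C.Step (1, x) a →
        ∃ ha : a.1 < C.haltLine + 1, Relation.ReflTransGen C.toVASS.Step
          (C.toVASS.init, x) ((⟨a.1, ha⟩ : Fin (C.haltLine + 1)), a.2) := by
      intro a h
      induction h with
      | refl => exact ⟨by simp [haltLine], .refl⟩
      | tail _ hs ih =>
        obtain ⟨_, ih⟩ := ih
        exact ⟨Nat.lt_succ_of_le (C.line_le hs), ih.tail ((C.step_toVASS _ _).2 hs)⟩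
    exact (key _ h).2

/-! ### Programs with zero tests -/

/-- Substitution of programs for the atomic actions. -/
def Prog.bind {α β : Type} (t : α → Prog β) : Prog α → Prog β
  | .skip => .skip
  | .atom a => t a
  | .seq P Q => .seq (P.bind t) (Q.bind t)
  | .choice P Q => .choice (P.bind t) (Q.bind t)
  | .star P => .star (P.bind t)

/-- Unit operations and zero tests. -/
inductive TestOp (ι : Type) : Type
  | inc (x : ι) : TestOp ι
  | dec (x : ι) : TestOp ι
  | test (x : ι) : TestOp ι

/-- Semantics of the unit operations and zero tests. -/
def TestOp.step {ι : Type} [DecidableEq ι] : TestOp ι → (ι → ℕ) → (ι → ℕ) → Prop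
  | .inc x => fun g g' => g' = Function.update g x (g x + 1)
  | .dec x => fun g g' => 0 < g x ∧ g' = Function.update g x (g x - 1)
  | .test x => fun g g' => g x = 0 ∧ g' = g

/-- The counters that simulate variables with zero tests: every variable has a complement, and
`cnt` and `prod` control the zero tests. -/
inductive Sim (ι : Type) : Type
  | pos (i : ι) : Sim ι
  | neg (i : ι) : Sim ι
  | cnt : Sim ι
  | prod : Sim ι
  deriving DecidableEq, Fintype

/-- The simulation of unit operations and zero tests by unit operations. The test of `x` moves
the complement of `x` to `x` and back, and counts the units that it moves. -/
def TestOp.sim {ι : Type} : TestOp ι → Prog (Op (Sim ι))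
  | .inc x => .seq (.atom (.inc (.pos x))) (.atom (.dec (.neg x)))
  | .dec x => .seq (.atom (.dec (.pos x))) (.atom (.inc (.neg x)))
  | .test x =>
    .seq (.star (.seq (.atom (.dec (.neg x))) (.seq (.atom (.inc (.pos x))) (.atom (.dec .prod)))))
    (.seq (.star (.seq (.atom (.dec (.pos x))) (.seq (.atom (.inc (.neg x))) (.atom (.dec .prod)))))
      (.atom (.dec .cnt)))

variable {ι : Type} [DecidableEq ι]

/-- A value and its complement sum up to `B`. -/
def Complementary (B : ℕ) (f : Sim ι → ℕ) : Prop := ∀ i, f (.pos i) + f (.neg i) = B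

/-- The quantity that grows when a zero test is passed illegally. -/
def excess (B : ℕ) (f : Sim ι → ℕ) : ℤ := f .prod - 2 * B * f .cnt

/-- A loop that moves units from `a` to `b` and counts them. -/
theorem move_sound {a b : Sim ι} (hab : a ≠ b) (ha : a ≠ .prod) (hb : b ≠ .prod)
    {f f' : Sim ι → ℕ}
    (h : Run Op.step (.star (.seq (.atom (.dec a)) (.seq (.atom (.inc b)) (.atom (.dec .prod)))))
      f f') :
    f a = f' a + (f .prod - f' .prod) ∧ f' b = f b + (f .prod - f' .prod) ∧ f' .prod ≤ f .prod ∧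
      ∀ s, s ≠ a → s ≠ b → s ≠ .prod → f' s = f s := by
  refine Run.star_induction (fun g => f a = g a + (f .prod - g .prod) ∧
    g b = f b + (f .prod - g .prod) ∧ g .prod ≤ f .prod ∧
      ∀ s, s ≠ a → s ≠ b → s ≠ .prod → g s = f s) ?_ h (by simp)
  rintro s t ⟨h₁, h₂, h₃, h₄⟩ hr
  simp only [run_seq, run_atom, Op.step] at hr
  obtain ⟨u, ⟨hu, rfl⟩, v, rfl, hv, rfl⟩ := hr
  simp only [Function.update_apply] at *
  refine ⟨?_, ?_, ?_, ?_⟩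
  · grind
  · grind
  · grind
  · grind

/-- Only tests touch `cnt` and `prod`. The first loop of a test moves at most `f (.neg x) ≤ B`
units, the second at most the resulting value of `.pos x`, again at most `B`. Unchanged excess means
that both moved exactly `B`, so the complement was full, that is, `x` was `0`, and it is full again
afterwards. -/
theorem TestOp.sim_sound (B : ℕ) (a : TestOp ι) {f f' : Sim ι → ℕ} (h : Run Op.step a.sim f f')
    (hf : Complementary B f) : Complementary B f' ∧ excess B f ≤ excess B f' ∧
      (excess B f = excess B f' → a.step (fun i => f (.pos i)) (fun i => f' (.pos i))) := by
  cases a with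
  | inc x =>
    simp only [sim, run_seq, run_atom, Op.step] at h
    obtain ⟨_, rfl, h₁, rfl⟩ := h
    refine ⟨fun i => ?_, ?_, fun _ => ?_⟩
    · have := hf i
      by_cases hi : i = x
      · subst hi; simp at h₁ ⊢; omega
      · simpa [hi] using this
    · simp [excess]
    · funext i
      by_cases hi : i = x
      · subst hi; simp
      · simp [hi]
  | dec x =>
    simp only [sim, run_seq, run_atom, Op.step] at h
    obtain ⟨_, ⟨h₁, rfl⟩, rfl⟩ := h
    refine ⟨fun i => ?_, ?_, fun _ => ⟨h₁, ?_⟩⟩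
    · have := hf i
      by_cases hi : i = x
      · subst hi; simp at h₁ ⊢; omega
      · simpa [hi] using this
    · simp [excess]
    · funext i
      by_cases hi : i = x
      · subst hi; simp
      · simp [hi]
  | test x =>
    simp only [sim] at h
    obtain ⟨u, hu, h⟩ := run_seq.1 h
    obtain ⟨v, hv, h⟩ := run_seq.1 h
    obtain ⟨hc, rfl⟩ := run_atom.1 h
    obtain ⟨u₁, u₂, u₃, u₄⟩ := move_sound (by simp) (by simp) (by simp) hu
    obtain ⟨v₁, v₂, v₃, v₄⟩ := move_sound (by simp) (by simp) (by simp) hv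
    have hcu : u .cnt = f .cnt := u₄ _ (by simp) (by simp) (by simp)
    have hcv : v .cnt = u .cnt := v₄ _ (by simp) (by simp) (by simp)
    have hp : ∀ i ≠ x, v (.pos i) = f (.pos i) := fun i hi => by
      rw [v₄ _ (by simpa) (by simp) (by simp), u₄ _ (by simp) (by simpa) (by simp)]
    have hn : ∀ i ≠ x, v (.neg i) = f (.neg i) := fun i hi => by
      rw [v₄ _ (by simp) (by simpa) (by simp), u₄ _ (by simpa) (by simp) (by simp)]
    have hx := hf x
    have he : excess B (Function.update v .cnt (v .cnt - 1)) =
        excess B f + (2 * B - (f .prod - v .prod : ℕ)) := by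
      have : ((v .cnt - 1 : ℕ) : ℤ) = f .cnt - 1 := by omega
      simp only [excess, Function.update_self, this, ne_eq, reduceCtorEq, not_false_eq_true,
        Function.update_of_ne, Nat.cast_sub (v₃.trans u₃)]
      ring
    rw [he]
    refine ⟨fun i => ?_, ?_, fun h => ⟨?_, ?_⟩⟩
    · have := hf i
      by_cases hi : i = x
      · subst hi; simp; omega
      · simpa [hp i hi, hn i hi] using this
    · omega
    · change f (.pos x) = 0
      omega
    · funext i
      by_cases hi : i = x
      · subst hi; simp; omega
      · simp [hp i hi]

/-- A run of the simulation that does not change the excess is a run of the simulated program. -/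
theorem Prog.sim_sound (B : ℕ) (P : Prog (TestOp ι)) {f f' : Sim ι → ℕ}
    (h : Run Op.step (P.bind TestOp.sim) f f') (hf : Complementary B f) :
    Complementary B f' ∧ excess B f ≤ excess B f' ∧ (excess B f = excess B f' →
      Run TestOp.step P (fun i => f (.pos i)) (fun i => f' (.pos i))) := by
  induction P generalizing f f' with
  | skip =>
    obtain rfl := run_skip.1 h
    exact ⟨hf, le_rfl, fun _ => .skip _⟩
  | atom a =>
    obtain ⟨h₁, h₂, h₃⟩ := a.sim_sound B h hf
    exact ⟨h₁, h₂, fun h => .atom (h₃ h)⟩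
  | seq P Q ihP ihQ =>
    obtain ⟨u, hu, h⟩ := run_seq.1 h
    obtain ⟨h₁, h₂, h₃⟩ := ihP hu hf
    obtain ⟨h₄, h₅, h₆⟩ := ihQ h h₁
    exact ⟨h₄, h₂.trans h₅, fun h => .seq (h₃ (by omega)) (h₆ (by omega))⟩
  | choice P Q ihP ihQ =>
    rcases run_choice.1 h with h | h
    · obtain ⟨h₁, h₂, h₃⟩ := ihP h hf
      exact ⟨h₁, h₂, fun h => .left (h₃ h)⟩
    · obtain ⟨h₁, h₂, h₃⟩ := ihQ h hf
      exact ⟨h₁, h₂, fun h => .right (h₃ h)⟩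
  | star P ih =>
    simp only [bind] at h
    generalize hR : Prog.star (P.bind TestOp.sim) = R at h
    induction h with
    | nil => exact ⟨hf, le_rfl, fun _ => .nil _⟩
    | cons h₁ h₂ _ ih₂ =>
      cases hR
      obtain ⟨h₁, h₂, h₃⟩ := ih h₁ hf
      obtain ⟨h₄, h₅, h₆⟩ := ih₂ h₁ rfl
      exact ⟨h₄, h₂.trans h₅, fun h => .cons (h₃ (by omega)) (h₆ (by omega))⟩
    | _ => cases hR

/-- The counters for the valuation `g`, when `c` zero tests remain. -/
def enc (B c : ℕ) (g : ι → ℕ) : Sim ι → ℕ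
  | .pos i => g i
  | .neg i => B - g i
  | .cnt => c
  | .prod => 2 * B * c

/-- The simulation of `P` with bound `B` can lead from `g` to `g'` with at most `K` tests. -/
def Exec (B : ℕ) (P : Prog (TestOp ι)) (K : ℕ) (g g' : ι → ℕ) : Prop :=
  (∀ i, g i ≤ B) → (∀ i, g' i ≤ B) ∧ ∃ k ≤ K, ∀ c,
    Run Op.step (P.bind TestOp.sim) (enc B (c + k) g) (enc B c g')

namespace Exec

variable {B K K' : ℕ} {P Q : Prog (TestOp ι)} {g g' g'' : ι → ℕ}

theorem mono (h : Exec B P K g g') (hK : K ≤ K') : Exec B P K' g g' := fun hg => by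
  obtain ⟨h₁, k, hk, h₂⟩ := h hg
  exact ⟨h₁, k, hk.trans hK, h₂⟩

theorem skip (g : ι → ℕ) : Exec B .skip 0 g g := fun hg => ⟨hg, 0, le_rfl, fun _ => .skip _⟩

/-- Composition works because `Exec` allows any number `c` of tests to be left over: those that `Q`
will consume are in store while `P` runs. -/
theorem seq (h : Exec B P K g g') (h' : Exec B Q K' g' g'') :
    Exec B (.seq P Q) (K + K') g g'' := fun hg => by
  obtain ⟨h₁, k, hk, h₂⟩ := h hg
  obtain ⟨h₁', k', hk', h₂'⟩ := h' h₁
  refine ⟨h₁', k + k', by omega, fun c => .seq ?_ (h₂' c)⟩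
  rw [show c + (k + k') = c + k' + k by ring]
  exact h₂ _

theorem left (h : Exec B P K g g') : Exec B (.choice P Q) K g g' := fun hg => by
  obtain ⟨h₁, k, hk, h₂⟩ := h hg
  exact ⟨h₁, k, hk, fun c => .left (h₂ c)⟩

theorem right (h : Exec B Q K g g') : Exec B (.choice P Q) K g g' := fun hg => by
  obtain ⟨h₁, k, hk, h₂⟩ := h hg
  exact ⟨h₁, k, hk, fun c => .right (h₂ c)⟩

theorem star (s : ℕ → ι → ℕ) (m : ℕ) (h : ∀ j < m, Exec B P K (s j) (s (j + 1))) :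
    Exec B (.star P) (m * K) (s 0) (s m) := by
  induction m generalizing s with
  | zero => exact fun hg => ⟨hg, 0, by omega, fun _ => .nil _⟩
  | succ m ih =>
    intro hg
    obtain ⟨h₁, k, hk, h₂⟩ := h 0 (by omega) hg
    obtain ⟨h₁', k', hk', h₂'⟩ := ih (fun j => s (j + 1)) (fun j hj => h (j + 1) (by omega)) h₁
    refine ⟨h₁', k + k', by rw [Nat.succ_mul]; omega, fun c => .cons ?_ (h₂' c)⟩
    rw [show c + (k + k') = c + k' + k by ring]
    exact h₂ _

theorem inc {x : ι} (hx : g x < B) (h : g' = Function.update g x (g x + 1)) :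
    Exec B (.atom (.inc x)) 0 g g' := by
  subst h
  refine fun hg => ⟨fun i => ?_, 0, le_rfl, fun c => .seq (.atom rfl) (.atom ⟨?_, ?_⟩)⟩
  · by_cases hi : i = x
    · subst hi; simpa using hx
    · simpa [hi] using hg i
  · simp [enc, hx]
  · funext s
    cases s with
    | pos i | neg i =>
      by_cases hi : i = x
      · subst hi; simp [enc]; try omega
      · simp [enc, hi]
    | _ => simp [enc]

theorem dec {x : ι} (hx : 0 < g x) (h : g' = Function.update g x (g x - 1)) :
    Exec B (.atom (.dec x)) 0 g g' := by
  subst h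
  refine fun hg => ⟨fun i => ?_, 0, le_rfl, fun c => .seq (.atom ⟨?_, rfl⟩) (.atom ?_)⟩
  · have := hg i
    by_cases hi : i = x
    · subst hi; simp; omega
    · simpa [hi] using hg i
  · simpa [enc] using hx
  · funext s
    cases s with
    | pos i | neg i =>
      have := hg i
      by_cases hi : i = x
      · subst hi; simp [enc]; try omega
      · simp [enc, hi]
    | _ => simp [enc]

/-- As `x` is `0`, its complement is `B`; both loops can move all `B` units, which lowers `prod` by
exactly the `2 * B` that one unit of `cnt` stands for. -/
theorem run_test {x : ι} (hx : g x = 0) (c : ℕ) :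
    Run Op.step (TestOp.test x).sim (enc B (c + 1) g) (enc B c g) := by
  let s : ℕ → ℕ → Sim ι → ℕ := fun j p => Function.update (Function.update (Function.update
    (enc B (c + 1) g) (.pos x) j) (.neg x) (B - j)) .prod p
  have h₁ : Run Op.step (.star (.seq (.atom (.dec (.neg x))) (.seq (.atom (.inc (.pos x)))
      (.atom (.dec .prod))))) (s 0 (2 * B * (c + 1))) (s B (2 * B * (c + 1) - B)) := by
    refine Run.star_of_chain (fun j => s j (2 * B * (c + 1) - j)) B fun j hj => ?_
    simp only [run_seq, run_atom, Op.step]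
    have hp : B ≤ 2 * B * (c + 1) := by nlinarith
    generalize 2 * B * (c + 1) = p at hp
    refine ⟨_, ⟨?_, rfl⟩, _, rfl, ?_, ?_⟩
    · simpa [s] using hj
    · simp [s]; omega
    · funext y
      simp only [s, Function.update_apply]
      grind
  have h₂ : Run Op.step (.star (.seq (.atom (.dec (.pos x))) (.seq (.atom (.inc (.neg x)))
      (.atom (.dec .prod))))) (s B (2 * B * (c + 1) - B)) (s 0 (2 * B * c)) := by
    have hp : 2 * B * (c + 1) - B = 2 * B * c + B := by
      rw [mul_add]; omega
    generalize 2 * B * c = p at hp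
    rw [hp]
    have := Run.star_of_chain (step := Op.step) (P := .seq (.atom (.dec (.pos x)))
      (.seq (.atom (.inc (.neg x))) (.atom (.dec .prod))))
      -- The way back: after `j` rounds, `B - j` units are still on `.pos x`.
      (fun j => s (B - j) (p + B - j)) B fun j hj => ?_
    · simpa using this
    simp only [run_seq, run_atom, Op.step]
    refine ⟨_, ⟨?_, rfl⟩, _, rfl, ?_, ?_⟩
    · simp [s]; omega
    · simp [s]; omega
    · funext y
      simp only [s, Function.update_apply]
      grind
  refine .seq (t := s B (2 * B * (c + 1) - B)) ?_ (.seq h₂ (.atom ⟨?_, ?_⟩))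
  · convert h₁ using 1
    funext y
    cases y with
    | pos i | neg i =>
      by_cases hi : i = x
      · subst hi; simp [s, enc, hx]
      · simp [s, enc, hi]
    | _ => simp [s, enc]
  · simp [s, enc]
  · funext y
    cases y with
    | pos i | neg i =>
      by_cases hi : i = x
      · subst hi; simp [s, enc, hx]
      · simp [s, enc, hi]
    | _ => simp [s, enc]

theorem test {x : ι} (hx : g x = 0) : Exec B (.atom (.test x)) 1 g g :=
  fun hg => ⟨hg, 1, le_rfl, fun c => run_test hx c⟩

end Exec

/-! ### Reductions to counter programs -/

/-- Decrements of the counters in a list. -/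
def drain {σ : Type} (l : List σ) : Prog (Op σ) :=
  l.foldr (fun x R => .seq (.star (.atom (.dec x))) R) .skip

theorem eq_of_run_drain {σ : Type} [DecidableEq σ] {l : List σ} {f f' : σ → ℕ}
    (h : Run Op.step (drain l) f f') {y : σ} (hy : y ∉ l) : f' y = f y := by
  induction l generalizing f with
  | nil => rw [run_skip.1 h]
  | cons x l ih =>
    obtain ⟨u, hu, h⟩ := run_seq.1 h
    simp only [List.mem_cons, not_or] at hy
    rw [ih h hy.2]
    refine Run.star_induction (fun g => g y = f y) ?_ hu rfl
    rintro s t hs ht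
    obtain ⟨-, rfl⟩ := run_atom.1 ht
    simpa [hy.1] using hs

theorem run_drain {σ : Type} [DecidableEq σ] (l : List σ) (f : σ → ℕ) :
    Run Op.step (drain l) f (fun y => if y ∈ l then 0 else f y) := by
  induction l generalizing f with
  | nil => exact .skip _
  | cons x l ih =>
    refine .seq (t := Function.update f x 0) ?_ ?_
    · have := Run.star_of_chain (step := Op.step) (P := .atom (.dec x))
        (fun j => Function.update f x (f x - j)) (f x) fun j hj => ?_
      · simpa using this
      · refine .atom ⟨by simpa using hj, ?_⟩
        simp [Nat.sub_sub]
    · change Run Op.step (drain l) _ _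
      convert ih (Function.update f x 0) using 1
      funext y
      by_cases hy : y = x
      · subst hy; simp
      · simp [hy]

/-- A set that is decided by a program with polynomially many zero tests, on variables with
polynomial initial values, reduces to the language of a counter program. -/
theorem arithReduces_of_program [Fintype ι] {k : ℕ} (L : Set (Fin k → ℕ))
    (P : Prog (TestOp ι)) (z : ι) (a : ι → MvPolynomial (Fin k) ℕ) (K : MvPolynomial (Fin k) ℕ)
    (sound : ∀ m g, Run TestOp.step P (fun i => (a i).eval m) g → m ∈ L)
    (complete : ∀ m ∈ L, ∃ g, g z = 0 ∧
      Exec (∑ i, (a i).eval m) P (K.eval m) (fun i => (a i).eval m) g) :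
    ∃ d : ℕ, 0 < d ∧ ∃ C : CounterProgram d, ArithReduces L C.language := by
  let e : Sim ι ≃ Fin (Fintype.card (Sim ι)) := Fintype.equivFin _
  -- `P` may use fewer tests than `cnt` provides; idle tests of `z`, which ends at `0`, consume the
  -- rest.
  let T : Prog (TestOp ι) := .seq P (.star (.atom (.test z)))
  -- The values of the variables may be discarded at the end, but `cnt` and `prod` must vanish by
  -- themselves: this is what certifies the tests.
  let l : List (Sim ι) := (Finset.univ.filter fun s : Sim ι => s ≠ .cnt ∧ s ≠ .prod).toList
  let R : Prog (Op (Sim ι)) := .seq (T.bind TestOp.sim) (drain l)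
  let b : Sim ι → MvPolynomial (Fin k) ℕ
    | .pos i => a i
    -- With `B` the sum of all initial values, each complement is the sum of the other values, so no
    -- subtraction is needed in the polynomials.
    | .neg i => ∑ j ∈ Finset.univ.erase i, a j
    | .cnt => K
    | .prod => 2 * (∑ j, a j) * K
  refine ⟨Fintype.card (Sim ι), Fintype.card_pos_iff.2 ⟨.cnt⟩, R.compile e,
    fun i => b (e.symm i), fun m => ?_⟩
  have hb : (fun s => (b s).eval m) = enc (∑ i, (a i).eval m) (K.eval m)
      (fun i => (a i).eval m) := by
    funext s
    cases s with
    | neg i =>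
      simp only [b, enc, map_sum]
      rw [← Finset.add_sum_erase Finset.univ _ (Finset.mem_univ i)]
      omega
    | _ => simp [b, enc]
  have ha : ∀ i, (a i).eval m ≤ ∑ i, (a i).eval m := fun i =>
    Finset.single_le_sum (f := fun i => (a i).eval m) (fun _ _ => Nat.zero_le _)
      (Finset.mem_univ i)
  have hl : ∀ s, s ∈ l ↔ s ≠ .cnt ∧ s ≠ .prod := by simp [l]
  change m ∈ L ↔ (fun s => (b s).eval m) ∘ e.symm ∈ (R.compile e).language
  rw [Prog.mem_language_compile, hb]
  replace complete := complete m
  generalize (∑ i, (a i).eval m) = B at *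
  constructor
  · intro hm
    obtain ⟨g, hg, hE⟩ := complete hm
    obtain ⟨h₁, j, hj, h₂⟩ := hE ha
    have h₃ := h₂ (K.eval m - j)
    rw [Nat.sub_add_cancel hj] at h₃
    generalize K.eval m - j = c at h₃
    have h₄ := Run.star_of_chain (step := Op.step) (P := (TestOp.test z).sim)
      (fun i => enc B (c - i) g) c fun i hi => by
        rw [show c - i = c - (i + 1) + 1 by omega]
        exact Exec.run_test hg _
    rw [Nat.sub_zero, Nat.sub_self] at h₄
    refine .seq (.seq h₃ h₄) ?_
    convert run_drain l (enc B 0 g) using 1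
    funext s
    cases s <;> simp [hl, enc]
  · intro h
    obtain ⟨u, hu, h⟩ := run_seq.1 h
    -- Draining leaves `cnt` and `prod` alone, so both are already `0` after `T`; the excess is then
    -- `0` before and after `T`, and all tests were honest.
    have h₁ : u .cnt = 0 := (eq_of_run_drain h (by simp [hl])).symm
    have h₂ : u .prod = 0 := (eq_of_run_drain h (by simp [hl])).symm
    have h₃ := (T.sim_sound B hu (fun i => Nat.add_sub_cancel' (ha i))).2.2
      (by simp [excess, enc, h₁, h₂])
    obtain ⟨v, hv, -⟩ := run_seq.1 h₃
    exact sound m v hv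

/-! ### Arithmetic with programs -/

/-- Increment. -/
abbrev incr (x : ι) : Prog (TestOp ι) := .atom (.inc x)

/-- Decrement. -/
abbrev decr (x : ι) : Prog (TestOp ι) := .atom (.dec x)

/-- Zero test. -/
abbrev zero (x : ι) : Prog (TestOp ι) := .atom (.test x)

/-- Adds `x` to `w`, by means of the auxiliary variable `s`. -/
def addTo (x w s : ι) : Prog (TestOp ι) :=
  .seq (.star (.seq (decr x) (.seq (incr w) (incr s)))) (.seq (zero x)
    (.seq (.star (.seq (decr s) (incr x))) (zero s)))

/-- Adds `x * y` to `w`, by means of the auxiliary variables `r` and `s`. -/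
def mulTo (x y w r s : ι) : Prog (TestOp ι) :=
  .seq (addTo x r s) (.seq (.star (.seq (decr r) (addTo y w s))) (zero r))

/-- Passes when `w = x`, and then sets `w` to `0`. -/
def eqTest (w x s : ι) : Prog (TestOp ι) :=
  .seq (.star (.seq (decr w) (.seq (decr x) (incr s)))) (.seq (zero w) (.seq (zero x)
    (.seq (.star (.seq (decr s) (incr x))) (zero s))))

/-- Passes when `w ≠ x`, and then sets `w` to `0`. -/
def neTest (w x s : ι) : Prog (TestOp ι) :=
  .seq (.choice (.seq (incr w) (.star (incr w))) (.seq (decr w) (.star (decr w))))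
    (eqTest w x s)

/-- Passes when `x ≤ y`. -/
def leTest (x y s : ι) : Prog (TestOp ι) :=
  .seq (.star (.seq (decr x) (.seq (decr y) (incr s)))) (.seq (zero x)
    (.seq (.star (.seq (decr s) (.seq (incr x) (incr y)))) (zero s)))

section Arithmetic

variable {x y w r s : ι} {g g' : ι → ℕ} {B : ℕ}

/-- Loops may stop at any time; the zero test after each one rules out a premature exit. The first
loop preserves `x + s` and `w - s`, the second `x + s`. -/
theorem addTo_sound (hxw : x ≠ w) (hxs : x ≠ s) (hws : w ≠ s) (hs : g s = 0)
    (h : Run TestOp.step (addTo x w s) g g') : g' = Function.update g w (g w + g x) := by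
  simp only [addTo, run_seq, run_atom, TestOp.step] at h
  obtain ⟨_, hu, u, ⟨hz, rfl⟩, v, hv, hz', rfl⟩ := h
  have h₁ : u x + u s = g x ∧ u w = g w + u s ∧ ∀ i, i ≠ x → i ≠ s → i ≠ w → u i = g i := by
    refine Run.star_induction (fun u => u x + u s = g x ∧ u w = g w + u s ∧
      ∀ i, i ≠ x → i ≠ s → i ≠ w → u i = g i) ?_ hu (by simp [hs])
    rintro a b ⟨h₁, h₂, h₃⟩ hr
    simp only [run_seq, run_atom, TestOp.step] at hr
    obtain ⟨_, ⟨ha, rfl⟩, _, rfl, rfl⟩ := hr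
    simp only [Function.update_apply]
    refine ⟨?_, ?_, ?_⟩ <;> grind
  have h₂ : g' x + g' s = g x ∧ ∀ i, i ≠ x → i ≠ s → g' i = u i := by
    refine Run.star_induction (fun v => v x + v s = g x ∧ ∀ i, i ≠ x → i ≠ s → v i = u i) ?_ hv
      ⟨h₁.1, fun _ _ _ => rfl⟩
    rintro a b ⟨h₁, h₂⟩ hr
    simp only [run_seq, run_atom, TestOp.step] at hr
    obtain ⟨_, ⟨ha, rfl⟩, rfl⟩ := hr
    simp only [Function.update_apply]
    refine ⟨?_, ?_⟩ <;> grind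
  funext i
  simp only [Function.update_apply]
  by_cases hx : i = x <;> by_cases hs : i = s <;> grind

theorem addTo_exec (hxw : x ≠ w) (hxs : x ≠ s) (hws : w ≠ s) (hs : g s = 0)
    (hB : g w + g x ≤ B) : Exec B (addTo x w s) 2 g (Function.update g w (g w + g x)) := by
  have h₁ := Exec.star (B := B) (K := 0) (P := .seq (decr x) (.seq (incr w) (incr s)))
    (fun j => Function.update (Function.update (Function.update g x (g x - j)) w (g w + j)) s j)
    (g x) fun j hj => by
      refine (Exec.dec ?_ rfl).seq ((Exec.inc ?_ rfl).seq (Exec.inc ?_ ?_))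
      · grind
      · grind
      · grind
      · funext i; grind
  have h₂ := Exec.star (B := B) (K := 0) (P := .seq (decr s) (incr x))
    (fun j => Function.update (Function.update (Function.update g x j) w (g w + g x)) s (g x - j))
    (g x) fun j hj => by
      refine (Exec.dec ?_ rfl).seq (Exec.inc ?_ ?_)
      · grind
      · grind
      · funext i; grind
  have e₁ : Function.update (Function.update (Function.update g x (g x - 0)) w (g w + 0)) s 0
      = g := by funext i; grind
  have e₂ : Function.update (Function.update (Function.update g x (g x)) w (g w + g x)) s
      (g x - g x) = Function.update g w (g w + g x) := by funext i; grind
  simp only [e₁] at h₁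
  simp only [e₂] at h₂
  simp only [Nat.sub_self, Nat.sub_zero] at h₁ h₂
  exact (h₁.seq ((Exec.test (by grind)).seq (h₂.seq (Exec.test (by grind))))).mono (by omega)

/-- The copy `r` of `x` counts the rounds, with invariant `w + r * y`. The case `x = y` is admitted,
so squares are covered. -/
theorem mulTo_sound (hxr : x ≠ r) (hxs : x ≠ s) (hyr : y ≠ r) (hyw : y ≠ w) (hys : y ≠ s)
    (hwr : w ≠ r) (hws : w ≠ s) (hrs : r ≠ s) (hr : g r = 0) (hs : g s = 0)
    (h : Run TestOp.step (mulTo x y w r s) g g') :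
    g' = Function.update g w (g w + g x * g y) := by
  obtain ⟨u, hu, h⟩ := run_seq.1 h
  obtain ⟨v, hv, h⟩ := run_seq.1 h
  obtain ⟨hz, rfl⟩ := run_atom.1 h
  have hu := addTo_sound hxr hxs hrs hs hu
  have h₁ : g' w + g' r * g y = g w + g x * g y ∧ ∀ i, i ≠ w → i ≠ r → g' i = g i := by
    refine Run.star_induction (fun v => v w + v r * g y = g w + g x * g y ∧
      ∀ i, i ≠ w → i ≠ r → v i = g i) ?_ hv ?_
    · rintro a b ⟨h₁, h₂⟩ hr
      obtain ⟨c, hc, hb⟩ := run_seq.1 hr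
      obtain ⟨ha, rfl⟩ := run_atom.1 hc
      have hb := addTo_sound hyw hys hws (by simp [hrs.symm, h₂ s hws.symm hrs.symm, hs]) hb
      obtain ⟨q, hq⟩ : ∃ q, a r = q + 1 := ⟨a r - 1, by omega⟩
      subst hb
      refine ⟨?_, fun i hi hi' => ?_⟩
      · simp [hwr, hwr.symm, hyr, hq, h₂ y hyw hyr] at h₁ ⊢
        linarith
      · simp [hi, hi', h₂ i hi hi']
    · subst hu
      refine ⟨?_, fun i hi hi' => ?_⟩
      · simp [hwr, hr]
      · simp [hi']
  funext i
  by_cases hi : i = w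
  · subst hi
    simpa [hz] using h₁.1
  · by_cases hi' : i = r
    · subst hi'
      simp [hi, hz, hr]
    · simp [hi, h₁.2 i hi hi']

theorem mulTo_exec (hxr : x ≠ r) (hxs : x ≠ s) (hyr : y ≠ r) (hyw : y ≠ w) (hys : y ≠ s)
    (hwr : w ≠ r) (hws : w ≠ s) (hrs : r ≠ s) (hr : g r = 0) (hs : g s = 0)
    (hx : g x ≤ B) (hB : g w + g x * g y ≤ B) :
    Exec B (mulTo x y w r s) (2 * g x + 3) g (Function.update g w (g w + g x * g y)) := by
  have h₁ := addTo_exec (B := B) hxr hxs hrs hs (by omega)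
  have h₂ := Exec.star (B := B) (K := 2) (P := .seq (decr r) (addTo y w s))
    (fun j => Function.update (Function.update g r (g x - j)) w (g w + j * g y))
    (g x) fun j hj => by
      have hle : (j + 1) * g y ≤ g x * g y := Nat.mul_le_mul_right _ hj
      have hsucc : (j + 1) * g y = j * g y + g y := by ring
      have h₃ := addTo_exec (B := B) (g := Function.update (Function.update g r (g x - (j + 1))) w
        (g w + j * g y)) hyw hys hws (by simp [hws.symm, hrs.symm, hs])
        (by simp [hyw, hyr]; omega)
      have e : Function.update (Function.update (Function.update g r (g x - (j + 1))) w
          (g w + j * g y)) w (g w + j * g y + g y) =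
          Function.update (Function.update g r (g x - (j + 1))) w (g w + (j + 1) * g y) := by
        rw [hsucc, Function.update_idem, add_assoc]
      simp only [Function.update_self, Function.update_of_ne hyw, Function.update_of_ne hyr,
        e] at h₃
      refine ((Exec.dec ?_ ?_).seq h₃).mono (Nat.zero_add 2).le
      · simp [hwr.symm]; omega
      · funext i; grind
  have e₁ : Function.update (Function.update g r (g x - 0)) w (g w + 0 * g y) =
      Function.update g r (g r + g x) := by funext i; grind
  have e₂ : Function.update (Function.update g r (g x - g x)) w (g w + g x * g y) =
      Function.update g w (g w + g x * g y) := by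
    rw [Nat.sub_self, ← hr, Function.update_eq_self]
  simp only [e₁, e₂] at h₂
  exact (h₁.seq (h₂.seq (Exec.test (by simp [hwr.symm, hr])))).mono (by omega)

theorem eqTest_sound (hxw : x ≠ w) (hxs : x ≠ s) (hws : w ≠ s) (hs : g s = 0)
    (h : Run TestOp.step (eqTest w x s) g g') : g' = Function.update g w 0 ∧ g w = g x := by
  simp only [eqTest, run_seq, run_atom, TestOp.step] at h
  obtain ⟨_, hu, _, ⟨hz, rfl⟩, u, ⟨hz₂, rfl⟩, v, hv, hz', rfl⟩ := h
  have h₁ : u x + u s = g x ∧ u w + u s = g w ∧ ∀ i, i ≠ x → i ≠ s → i ≠ w → u i = g i := by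
    refine Run.star_induction (fun u => u x + u s = g x ∧ u w + u s = g w ∧
      ∀ i, i ≠ x → i ≠ s → i ≠ w → u i = g i) ?_ hu (by simp [hs])
    rintro a b ⟨h₁, h₂, h₃⟩ hr
    simp only [run_seq, run_atom, TestOp.step] at hr
    obtain ⟨_, ⟨ha, rfl⟩, _, ⟨ha', rfl⟩, rfl⟩ := hr
    simp only [Function.update_apply] at *
    refine ⟨?_, ?_, ?_⟩ <;> grind
  have h₂ : g' x + g' s = g x ∧ ∀ i, i ≠ x → i ≠ s → g' i = u i := by
    refine Run.star_induction (fun v => v x + v s = g x ∧ ∀ i, i ≠ x → i ≠ s → v i = u i) ?_ hv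
      ⟨h₁.1, fun _ _ _ => rfl⟩
    rintro a b ⟨h₁, h₂⟩ hr
    simp only [run_seq, run_atom, TestOp.step] at hr
    obtain ⟨_, ⟨ha, rfl⟩, rfl⟩ := hr
    simp only [Function.update_apply]
    refine ⟨?_, ?_⟩ <;> grind
  refine ⟨?_, by omega⟩
  funext i
  simp only [Function.update_apply]
  by_cases hx : i = x <;> by_cases hs : i = s <;> grind

theorem eqTest_exec (hxw : x ≠ w) (hxs : x ≠ s) (hws : w ≠ s) (hs : g s = 0)
    (hB : g x ≤ B) (h : g w = g x) : Exec B (eqTest w x s) 3 g (Function.update g w 0) := by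
  have h₁ := Exec.star (B := B) (K := 0) (P := .seq (decr w) (.seq (decr x) (incr s)))
    (fun j => Function.update (Function.update (Function.update g x (g x - j)) w (g x - j)) s j)
    (g x) fun j hj => by
      refine (Exec.dec ?_ rfl).seq ((Exec.dec ?_ rfl).seq (Exec.inc ?_ ?_))
      · grind
      · grind
      · grind
      · funext i; grind
  have h₂ := Exec.star (B := B) (K := 0) (P := .seq (decr s) (incr x))
    (fun j => Function.update (Function.update (Function.update g x j) w 0) s (g x - j))
    (g x) fun j hj => by
      refine (Exec.dec ?_ rfl).seq (Exec.inc ?_ ?_)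
      · grind
      · grind
      · funext i; grind
  have e₁ : Function.update (Function.update (Function.update g x (g x - 0)) w (g x - 0)) s 0
      = g := by funext i; grind
  have e₂ : Function.update (Function.update (Function.update g x (g x)) w 0) s
      (g x - g x) = Function.update g w 0 := by funext i; grind
  simp only [e₁] at h₁
  simp only [e₂] at h₂
  simp only [Nat.sub_self, Nat.sub_zero] at h₁ h₂
  exact (h₁.seq ((Exec.test (by grind)).seq ((Exec.test (by grind)).seq
    (h₂.seq (Exec.test (by grind)))))).mono (by omega)

/-- The choice shifts `w` by a positive amount in one direction only. If the shifted value equals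
`x`, the original one did not. -/
theorem neTest_sound (hxw : x ≠ w) (hxs : x ≠ s) (hws : w ≠ s) (hs : g s = 0)
    (h : Run TestOp.step (neTest w x s) g g') : g' = Function.update g w 0 ∧ g w ≠ g x := by
  obtain ⟨u, hu, h⟩ := run_seq.1 h
  have h₁ : u w ≠ g w ∧ ∀ i, i ≠ w → u i = g i := by
    rcases run_choice.1 hu with hu | hu
    · obtain ⟨v, hv, hu⟩ := run_seq.1 hu
      obtain rfl : v = Function.update g w (g w + 1) := run_atom.1 hv
      have : g w < u w ∧ ∀ i, i ≠ w → u i = g i := by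
        refine Run.star_induction (fun u => g w < u w ∧ ∀ i, i ≠ w → u i = g i) ?_ hu ?_
        · rintro a b ⟨h₁, h₂⟩ hr
          obtain rfl : b = Function.update a w (a w + 1) := run_atom.1 hr
          grind
        · grind
      exact ⟨by omega, this.2⟩
    · obtain ⟨v, hv, hu⟩ := run_seq.1 hu
      obtain ⟨h₃, rfl⟩ : 0 < g w ∧ v = Function.update g w (g w - 1) := run_atom.1 hv
      have : u w < g w ∧ ∀ i, i ≠ w → u i = g i := by
        refine Run.star_induction (fun u => u w < g w ∧ ∀ i, i ≠ w → u i = g i) ?_ hu ?_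
        · rintro a b ⟨h₁, h₂⟩ hr
          obtain ⟨h₃, rfl⟩ : 0 < a w ∧ b = Function.update a w (a w - 1) := run_atom.1 hr
          grind
        · grind
      exact ⟨by omega, this.2⟩
  obtain ⟨rfl, h₂⟩ := eqTest_sound hxw hxs hws (by grind) h
  refine ⟨?_, by grind⟩
  funext i
  grind

theorem neTest_exec (hxw : x ≠ w) (hxs : x ≠ s) (hws : w ≠ s) (hs : g s = 0)
    (hB : g x ≤ B) (h : g w ≠ g x) : Exec B (neTest w x s) 3 g (Function.update g w 0) := by
  have h₁ : Exec B (.choice (.seq (incr w) (.star (incr w))) (.seq (decr w) (.star (decr w)))) 0 g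
      (Function.update g w (g x)) := by
    rcases Nat.lt_or_gt_of_ne h with h | h
    · have h₁ := Exec.star (B := B) (K := 0) (P := incr w)
        (fun j => Function.update g w (g w + 1 + j)) (g x - (g w + 1)) fun j hj =>
          Exec.inc (by grind) (by funext i; grind)
      simp only [Nat.add_zero, Nat.add_sub_cancel' (show g w + 1 ≤ g x from h)] at h₁
      exact (((Exec.inc (by omega) rfl).seq h₁).left).mono (by omega)
    · have h₁ := Exec.star (B := B) (K := 0) (P := decr w)
        (fun j => Function.update g w (g w - 1 - j)) (g w - 1 - g x) fun j hj =>
          Exec.dec (by grind) (by funext i; grind)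
      simp only [Nat.sub_zero, Nat.sub_sub_self (show g x ≤ g w - 1 by omega)] at h₁
      exact (((Exec.dec (by omega) rfl).seq h₁).right).mono (by omega)
  have h₂ := eqTest_exec (B := B) (g := Function.update g w (g x)) hxw hxs hws
    (by simp [hws.symm, hs]) (by simpa [hxw] using hB) (by simp [hxw])
  rw [Function.update_idem] at h₂
  exact (h₁.seq h₂).mono (by omega)

theorem leTest_sound (hxy : x ≠ y) (hxs : x ≠ s) (hys : y ≠ s) (hs : g s = 0)
    (h : Run TestOp.step (leTest x y s) g g') : g' = g ∧ g x ≤ g y := by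
  simp only [leTest, run_seq, run_atom, TestOp.step] at h
  obtain ⟨_, hu, u, ⟨hz, rfl⟩, v, hv, hz', rfl⟩ := h
  have h₁ : u x + u s = g x ∧ u y + u s = g y ∧ ∀ i, i ≠ x → i ≠ s → i ≠ y → u i = g i := by
    refine Run.star_induction (fun u => u x + u s = g x ∧ u y + u s = g y ∧
      ∀ i, i ≠ x → i ≠ s → i ≠ y → u i = g i) ?_ hu (by simp [hs])
    rintro a b ⟨h₁, h₂, h₃⟩ hr
    simp only [run_seq, run_atom, TestOp.step] at hr
    obtain ⟨_, ⟨ha, rfl⟩, _, ⟨ha', rfl⟩, rfl⟩ := hr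
    simp only [Function.update_apply] at *
    refine ⟨?_, ?_, ?_⟩ <;> grind
  have h₂ : g' x + g' s = g x ∧ g' y + g' s = g y ∧
      ∀ i, i ≠ x → i ≠ s → i ≠ y → g' i = g i := by
    refine Run.star_induction (fun u => u x + u s = g x ∧ u y + u s = g y ∧
      ∀ i, i ≠ x → i ≠ s → i ≠ y → u i = g i) ?_ hv h₁
    rintro a b ⟨h₁, h₂, h₃⟩ hr
    simp only [run_seq, run_atom, TestOp.step] at hr
    obtain ⟨_, ⟨ha, rfl⟩, _, rfl, rfl⟩ := hr
    simp only [Function.update_apply] at *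
    refine ⟨?_, ?_, ?_⟩ <;> grind
  refine ⟨?_, by omega⟩
  funext i
  by_cases hx : i = x <;> by_cases hy : i = y <;> by_cases hs : i = s <;> grind

theorem leTest_exec (hxy : x ≠ y) (hxs : x ≠ s) (hys : y ≠ s) (hs : g s = 0)
    (hB : g y ≤ B) (h : g x ≤ g y) : Exec B (leTest x y s) 2 g g := by
  have h₁ := Exec.star (B := B) (K := 0) (P := .seq (decr x) (.seq (decr y) (incr s)))
    (fun j => Function.update (Function.update (Function.update g x (g x - j)) y (g y - j)) s j)
    (g x) fun j hj => by
      refine (Exec.dec ?_ rfl).seq ((Exec.dec ?_ rfl).seq (Exec.inc ?_ ?_))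
      · grind
      · grind
      · grind
      · funext i; grind
  have h₂ := Exec.star (B := B) (K := 0) (P := .seq (decr s) (.seq (incr x) (incr y)))
    (fun j => Function.update (Function.update (Function.update g x j) y (g y - g x + j)) s
      (g x - j)) (g x) fun j hj => by
      refine (Exec.dec ?_ rfl).seq ((Exec.inc ?_ rfl).seq (Exec.inc ?_ ?_))
      · grind
      · grind
      · grind
      · funext i; grind
  have e₁ : Function.update (Function.update (Function.update g x (g x - 0)) y (g y - 0)) s 0
      = g := by funext i; grind
  have e₂ : Function.update (Function.update (Function.update g x (g x)) y (g y - g x + g x)) s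
      (g x - g x) = g := by funext i; grind
  simp only [e₁] at h₁
  simp only [e₂] at h₂
  simp only [Nat.sub_self, Nat.sub_zero, Nat.add_zero] at h₁ h₂
  exact (h₁.seq ((Exec.test (by grind)).seq (h₂.seq (Exec.test (by grind))))).mono (by omega)

end Arithmetic

/-! ### Guards -/

/-- From the valuation `g`, the program `P` can only return to `g`; it can do so only when `p`
holds, and then with at most `K` zero tests, if the bound is not too small. -/
def Guard (P : Prog (TestOp ι)) (K N : ℕ) (g : ι → ℕ) (p : Prop) : Prop :=
  (p → ∀ B, N * N + 2 * N ≤ B → Exec B P K g g) ∧ ∀ g', Run TestOp.step P g g' → g' = g ∧ p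

namespace Guard

variable {P Q : Prog (TestOp ι)} {K K' N : ℕ} {g : ι → ℕ} {p q : Prop}

theorem mono (h : Guard P K N g p) (hK : K ≤ K') : Guard P K' N g p :=
  ⟨fun hp B hB => (h.1 hp B hB).mono hK, h.2⟩

theorem congr (h : Guard P K N g p) (hpq : p ↔ q) : Guard P K N g q :=
  ⟨fun hq => h.1 (hpq.2 hq), fun g' hg' => ⟨(h.2 g' hg').1, hpq.1 (h.2 g' hg').2⟩⟩

theorem skip (N : ℕ) (g : ι → ℕ) : Guard .skip 0 N g True :=
  ⟨fun _ _ _ => .skip g, fun _ h => ⟨run_skip.1 h, trivial⟩⟩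

/-- A decrement right after a passed zero test of the same variable blocks. -/
theorem fail (s : ι) (N : ℕ) (g : ι → ℕ) : Guard (.seq (zero s) (decr s)) 0 N g False := by
  refine ⟨False.elim, fun g' h => ?_⟩
  obtain ⟨_, h, h'⟩ := run_seq.1 h
  obtain ⟨h, rfl⟩ := run_atom.1 h
  have := (run_atom.1 h').1
  omega

theorem seq (h : Guard P K N g p) (h' : Guard Q K' N g q) :
    Guard (.seq P Q) (K + K') N g (p ∧ q) := by
  refine ⟨fun hpq B hB => (h.1 hpq.1 B hB).seq (h'.1 hpq.2 B hB), fun g' hg' => ?_⟩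
  obtain ⟨u, hu, hu'⟩ := run_seq.1 hg'
  obtain ⟨rfl, hp⟩ := h.2 u hu
  obtain ⟨h₁, hq⟩ := h'.2 _ hu'
  exact ⟨h₁, hp, hq⟩

theorem choice (h : Guard P K N g p) (h' : Guard Q K' N g q) :
    Guard (.choice P Q) (K + K') N g (p ∨ q) := by
  refine ⟨fun hpq B hB => ?_, fun g' hg' => ?_⟩
  · rcases hpq with hp | hq
    · exact ((h.1 hp B hB).left).mono (by omega)
    · exact ((h'.1 hq B hB).right).mono (by omega)
  · rcases run_choice.1 hg' with hg' | hg'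
    · exact ⟨(h.2 g' hg').1, .inl (h.2 g' hg').2⟩
    · exact ⟨(h'.2 g' hg').1, .inr (h'.2 g' hg').2⟩

end Guard

/-- From the valuation `g`, the program `P` sets `w` to `val`. -/
def Computes (P : Prog (TestOp ι)) (K N : ℕ) (g : ι → ℕ) (w : ι) (val : ℕ) : Prop :=
  (∀ B, N * N + 2 * N ≤ B → Exec B P K g (Function.update g w val)) ∧
    ∀ g', Run TestOp.step P g g' → g' = Function.update g w val

section Atoms

variable {P : Prog (TestOp ι)} {K N val : ℕ} {g : ι → ℕ} {w x y r s : ι}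

theorem Computes.guard_eq (h : Computes P K N g w val) (hxw : x ≠ w) (hxs : x ≠ s) (hws : w ≠ s)
    (hw : g w = 0) (hs : g s = 0) (hx : g x ≤ N) :
    Guard (.seq P (eqTest w x s)) (K + 3) N g (val = g x) := by
  have e : Function.update (Function.update g w val) w 0 = g := by simp [← hw]
  refine ⟨fun hv B hB => ?_, fun g' hg' => ?_⟩
  · have := eqTest_exec (B := B) (g := Function.update g w val) hxw hxs hws
      (by simp [hws.symm, hs]) (by simp [hxw]; nlinarith) (by simp [hxw, hv])
    rw [e] at this
    exact (h.1 B hB).seq this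
  · obtain ⟨u, hu, hg'⟩ := run_seq.1 hg'
    obtain rfl := h.2 u hu
    have := eqTest_sound hxw hxs hws (by simp [hws.symm, hs]) hg'
    simpa [e, hxw] using this

theorem Computes.guard_ne (h : Computes P K N g w val) (hxw : x ≠ w) (hxs : x ≠ s) (hws : w ≠ s)
    (hw : g w = 0) (hs : g s = 0) (hx : g x ≤ N) :
    Guard (.seq P (neTest w x s)) (K + 3) N g (¬ val = g x) := by
  have e : Function.update (Function.update g w val) w 0 = g := by simp [← hw]
  refine ⟨fun hv B hB => ?_, fun g' hg' => ?_⟩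
  · have := neTest_exec (B := B) (g := Function.update g w val) hxw hxs hws
      (by simp [hws.symm, hs]) (by simp [hxw]; nlinarith) (by simpa [hxw] using hv)
    rw [e] at this
    exact (h.1 B hB).seq this
  · obtain ⟨u, hu, hg'⟩ := run_seq.1 hg'
    obtain rfl := h.2 u hu
    have := neTest_sound hxw hxs hws (by simp [hws.symm, hs]) hg'
    simpa [e, hxw] using this

theorem computes_addTo (hxw : x ≠ w) (hxs : x ≠ s) (hws : w ≠ s) (hw : g w = 0) (hs : g s = 0)
    (hx : g x ≤ N) : Computes (addTo x w s) 2 N g w (g x) := by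
  refine ⟨fun B hB => ?_, fun g' hg' => ?_⟩
  · have := addTo_exec (B := B) hxw hxs hws hs (by nlinarith)
    rwa [hw, zero_add] at this
  · have := addTo_sound hxw hxs hws hs hg'
    rwa [hw, zero_add] at this

theorem computes_add (hxw : x ≠ w) (hxs : x ≠ s) (hyw : y ≠ w) (hys : y ≠ s) (hws : w ≠ s)
    (hw : g w = 0) (hs : g s = 0) (hx : g x ≤ N) (hy : g y ≤ N) :
    Computes (.seq (addTo x w s) (addTo y w s)) 4 N g w (g x + g y) := by
  have h := computes_addTo hxw hxs hws hw hs hx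
  refine ⟨fun B hB => ?_, fun g' hg' => ?_⟩
  · have := addTo_exec (B := B) (g := Function.update g w (g x)) hyw hys hws
      (by simp [hws.symm, hs]) (by simp [hyw]; nlinarith)
    refine ((h.1 B hB).seq this).mono le_rfl |> fun h => ?_
    simpa [hyw] using h
  · obtain ⟨u, hu, hg'⟩ := run_seq.1 hg'
    obtain rfl := h.2 u hu
    have := addTo_sound hyw hys hws (by simp [hws.symm, hs]) hg'
    simpa [hyw] using this

/-- Products of values up to `N` need room `N * N`, sums need `2 * N`; hence the bound `N * N + 2 *
N` in `Guard` and `Computes`. -/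
theorem computes_mul (hxr : x ≠ r) (hxs : x ≠ s) (hyr : y ≠ r) (hyw : y ≠ w) (hys : y ≠ s)
    (hwr : w ≠ r) (hws : w ≠ s) (hrs : r ≠ s) (hw : g w = 0) (hr : g r = 0) (hs : g s = 0)
    (hx : g x ≤ N) (hy : g y ≤ N) :
    Computes (mulTo x y w r s) (2 * N + 3) N g w (g x * g y) := by
  refine ⟨fun B hB => ?_, fun g' hg' => ?_⟩
  · have hxy : g x * g y ≤ N * N := Nat.mul_le_mul hx hy
    have := mulTo_exec (B := B) hxr hxs hyr hyw hys hwr hws hrs hr hs (by omega) (by omega)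
    rw [hw, zero_add] at this
    exact this.mono (by omega)
  · have := mulTo_sound hxr hxs hyr hyw hys hwr hws hrs hr hs hg'
    rwa [hw, zero_add] at this

theorem guard_le (hxy : x ≠ y) (hxs : x ≠ s) (hys : y ≠ s) (hs : g s = 0) (hy : g y ≤ N) :
    Guard (leTest x y s) 2 N g (g x ≤ g y) :=
  ⟨fun h B hB => leTest_exec hxy hxs hys hs (by nlinarith) h,
    fun _ h => leTest_sound hxy hxs hys hs h⟩

end Atoms

/-! ### Bounded quantifiers -/

/-- Increases the value of the pair `(x, u)`. -/
def next (x u : ι) : Prog (TestOp ι) := .seq (incr x) (decr u)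

/-- Resets the value of the pair `(x, u)`. -/
def reset (x u : ι) : Prog (TestOp ι) := .seq (.star (.seq (decr x) (incr u))) (zero x)

/-- Universal quantification over the values of the pair `(x, u)`. -/
def forallProg (x u : ι) (P : Prog (TestOp ι)) : Prog (TestOp ι) :=
  .seq (.star (.seq P (next x u))) (.seq P (.seq (zero u) (reset x u)))

/-- Existential quantification over the values of the pair `(x, u)`. -/
def existsProg (x u : ι) (P : Prog (TestOp ι)) : Prog (TestOp ι) :=
  .seq (.star (next x u)) (.seq P (reset x u))

/-- The valuation `g` with the pair `(x, u)` set to `a` and `N - a`. -/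
def setPair (N : ℕ) (g : ι → ℕ) (x u : ι) (a : ℕ) : ι → ℕ :=
  Function.update (Function.update g x a) u (N - a)

section Quantifiers

variable {N B a : ℕ} {g g' : ι → ℕ} {x u : ι} {P : Prog (TestOp ι)} {K : ℕ} {p : ℕ → Prop}

theorem next_sound (hxu : x ≠ u) (h : Run TestOp.step (next x u) (setPair N g x u a) g') :
    a < N ∧ g' = setPair N g x u (a + 1) := by
  simp only [next, run_seq, run_atom, TestOp.step] at h
  obtain ⟨_, rfl, h, rfl⟩ := h
  simp only [setPair] at *
  refine ⟨by grind, ?_⟩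
  funext i
  grind

theorem next_exec (hxu : x ≠ u) (ha : a < N) (hB : N ≤ B) :
    Exec B (next x u) 0 (setPair N g x u a) (setPair N g x u (a + 1)) := by
  refine (Exec.inc ?_ rfl).seq (Exec.dec ?_ ?_)
  · simp only [setPair]; grind
  · simp only [setPair]; grind
  · funext i; simp only [setPair]; grind

theorem reset_sound (hxu : x ≠ u) (ha : a ≤ N)
    (h : Run TestOp.step (reset x u) (setPair N g x u a) g') : g' = setPair N g x u 0 := by
  obtain ⟨v, hv, h⟩ := run_seq.1 h
  obtain ⟨hz, rfl⟩ := run_atom.1 h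
  have : ∃ b ≤ N, g' = setPair N g x u b := by
    refine Run.star_induction (fun h => ∃ b ≤ N, h = setPair N g x u b) ?_ hv ⟨a, ha, rfl⟩
    rintro _ t ⟨b, hb, rfl⟩ hr
    simp only [run_seq, run_atom, TestOp.step] at hr
    obtain ⟨_, ⟨h, rfl⟩, rfl⟩ := hr
    simp only [setPair] at h
    refine ⟨b - 1, by omega, ?_⟩
    funext i
    simp only [setPair]
    grind
  obtain ⟨b, hb, rfl⟩ := this
  simp only [setPair] at hz
  have : b = 0 := by grind
  rw [this]

theorem reset_exec (hxu : x ≠ u) (ha : a ≤ N) (hB : N ≤ B) :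
    Exec B (reset x u) 1 (setPair N g x u a) (setPair N g x u 0) := by
  have h₁ := Exec.star (B := B) (K := 0) (P := .seq (decr x) (incr u))
    (fun j => setPair N g x u (a - j)) a fun j hj => by
      refine (Exec.dec ?_ rfl).seq (Exec.inc ?_ ?_)
      · simp only [setPair]; grind
      · simp only [setPair]; grind
      · funext i; simp only [setPair]; grind
  simp only [Nat.sub_zero, Nat.sub_self] at h₁
  exact (h₁.seq (Exec.test (by simp only [setPair]; grind))).mono (by omega)

/-- The pair keeps the sum `N`, so `next` blocks at `N`, and `zero u` forces the loop to get there.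
The value `N` is checked after the loop. The tests are `N * K` in the loop, `K` for the last value,
and one each for `zero u` and `reset`. -/
theorem guard_forall (hxu : x ≠ u)
    (h : ∀ a ≤ N, Guard P K N (setPair N g x u a) (p a)) :
    Guard (forallProg x u P) (N * K + K + 2) N (setPair N g x u 0) (∀ a ≤ N, p a) := by
  refine ⟨fun hp B hB => ?_, fun g' hg' => ?_⟩
  · have hNB : N ≤ B := by nlinarith
    have h₁ := Exec.star (B := B) (K := K) (P := .seq P (next x u)) (setPair N g x u) N
      fun j hj => ((h j hj.le).1 (hp j hj.le) B hB).seq (next_exec hxu hj hNB)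
    exact (h₁.seq (((h N le_rfl).1 (hp N le_rfl) B hB).seq ((Exec.test (by simp [setPair])).seq
      (reset_exec hxu le_rfl hNB)))).mono (by omega)
  · obtain ⟨v, hv, hg'⟩ := run_seq.1 hg'
    have h₁ : ∃ a ≤ N, v = setPair N g x u a ∧ ∀ b < a, p b := by
      refine Run.star_induction (fun v => ∃ a ≤ N, v = setPair N g x u a ∧ ∀ b < a, p b) ?_ hv
        ⟨0, by omega, rfl, by simp⟩
      rintro _ t ⟨a, ha, rfl, hb⟩ hr
      obtain ⟨w, hw, hr⟩ := run_seq.1 hr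
      obtain ⟨rfl, hpa⟩ := (h a ha).2 w hw
      obtain ⟨ha', rfl⟩ := next_sound hxu hr
      refine ⟨a + 1, ha', rfl, fun b hb' => ?_⟩
      rcases Nat.lt_succ_iff_lt_or_eq.1 hb' with h | rfl
      · exact hb b h
      · exact hpa
    obtain ⟨a, ha, rfl, hb⟩ := h₁
    obtain ⟨w, hw, hg'⟩ := run_seq.1 hg'
    obtain ⟨rfl, hpa⟩ := (h a ha).2 w hw
    obtain ⟨w, hw, hg'⟩ := run_seq.1 hg'
    obtain ⟨hz, rfl⟩ := run_atom.1 hw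
    have haN : a = N := by
      simp only [setPair, Function.update_self] at hz
      omega
    refine ⟨reset_sound hxu ha hg', fun b hb' => ?_⟩
    rcases Nat.lt_or_eq_of_le (haN ▸ hb') with h | rfl
    · exact hb b h
    · exact hpa

theorem guard_exists (hxu : x ≠ u)
    (h : ∀ a ≤ N, Guard P K N (setPair N g x u a) (p a)) :
    Guard (existsProg x u P) (K + 1) N (setPair N g x u 0) (∃ a ≤ N, p a) := by
  refine ⟨?_, fun g' hg' => ?_⟩
  · rintro ⟨a, ha, hp⟩ B hB
    have hNB : N ≤ B := by nlinarith
    have h₁ := Exec.star (B := B) (K := 0) (P := next x u) (setPair N g x u) a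
      fun j hj => next_exec hxu (by omega) hNB
    exact (h₁.seq (((h a ha).1 hp B hB).seq (reset_exec hxu ha hNB))).mono (by omega)
  · obtain ⟨v, hv, hg'⟩ := run_seq.1 hg'
    have h₁ : ∃ a ≤ N, v = setPair N g x u a := by
      refine Run.star_induction (fun v => ∃ a ≤ N, v = setPair N g x u a) ?_ hv
        ⟨0, by omega, rfl⟩
      rintro _ t ⟨a, ha, rfl⟩ hr
      obtain ⟨ha', rfl⟩ := next_sound hxu hr
      exact ⟨a + 1, ha', rfl⟩
    obtain ⟨a, ha, rfl⟩ := h₁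
    obtain ⟨w, hw, hg'⟩ := run_seq.1 hg'
    obtain ⟨rfl, hpa⟩ := (h a ha).2 w hw
    exact ⟨reset_sound hxu ha hg', a, ha, hpa⟩

end Quantifiers

open FirstOrder FirstOrder.Language

/-! ### Evaluation of formulas -/

/-- The variables of the program for a formula with `n` free variables and quantifier depth at
most `D`: the inputs, a pair `val i`, `gap i` for the bound variable `i`, three auxiliary variables,
the bound on the inputs, and a variable that makes the bound of the simulation large. -/
inductive Var (n D : ℕ) : Type
  | input (i : Fin n) : Var n D
  | val (i : Fin D) : Var n D
  | gap (i : Fin D) : Var n D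
  | acc : Var n D
  | aux : Var n D
  | tmp : Var n D
  | bound : Var n D
  | pad : Var n D
  deriving DecidableEq, Fintype

/-- The valuation with inputs `v` and values `b` of the bound variables. -/
def valuation {n D : ℕ} (N : ℕ) (v : Fin n → ℕ) (b : Fin D → ℕ) : Var n D → ℕ
  | .input i => v i
  | .val i => b i
  | .gap i => N - b i
  | .bound => N
  | .pad => N * N + 2 * N
  | _ => 0

/-- The values of all bound variables, those that are out of scope being `0`. -/
def extendZero {k N : ℕ} (D : ℕ) (xs : Fin k → Segment N) (i : Fin D) : ℕ :=
  if h : i.1 < k then (xs ⟨i, h⟩).1 else 0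

/-- The valuation of the variables for an assignment. -/
def assignment {n k N : ℕ} (D : ℕ) (v : Fin n → Segment N) (xs : Fin k → Segment N) :
    Var n D → ℕ := valuation N (fun i => (v i).1) (extendZero D xs)

theorem setPair_valuation {n D : ℕ} (N : ℕ) (v : Fin n → ℕ) (b : Fin D → ℕ) (i : Fin D) (a : ℕ) :
    setPair N (valuation N v b) (.val i) (.gap i) a =
      valuation N v (Function.update b i a) := by
  funext x
  cases x with
  | val j | gap j =>
    by_cases hj : j = i
    · subst hj; simp [setPair, valuation]
    · simp [setPair, valuation, hj]
  | _ => simp [setPair, valuation]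

theorem setPair_assignment {n k N D : ℕ} (hk : k < D) (v : Fin n → Segment N)
    (xs : Fin k → Segment N) (a : Segment N) :
    setPair N (assignment D v xs) (.val ⟨k, hk⟩) (.gap ⟨k, hk⟩) a.1 =
      assignment D v (Fin.snoc xs a) := by
  rw [assignment, setPair_valuation, assignment]
  congr 1
  funext i
  by_cases hi : i = ⟨k, hk⟩
  · subst hi; simp [extendZero, Fin.snoc]
  · have : i.1 ≠ k := fun h => hi (Fin.ext h)
    rw [Function.update_of_ne hi]
    simp only [extendZero, Fin.snoc]
    split_ifs <;> first | rfl | omega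

/-- Since variables out of scope have value `0`, the pair of a fresh variable is already in its
starting position and needs no initialization code. -/
theorem setPair_assignment_zero {n k N D : ℕ} (hk : k < D) (v : Fin n → Segment N)
    (xs : Fin k → Segment N) :
    setPair N (assignment D v xs) (.val ⟨k, hk⟩) (.gap ⟨k, hk⟩) 0 = assignment D v xs := by
  rw [assignment, setPair_valuation]
  congr 1
  simp [extendZero]

/-- Satisfaction and dissatisfaction of the formula are decided by guards with polynomially many
zero tests. -/
def Guarded {n k : ℕ} (φ : arith.BoundedFormula (Fin n) k) : Prop :=
  ∃ D₀, ∀ D ≥ D₀, ∃ (T F : Prog (TestOp (Var n D))) (K : Polynomial ℕ),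
    ∀ (N : ℕ) (v : Fin n → Segment N) (xs : Fin k → Segment N),
      Guard T (K.eval N) N (assignment D v xs) (φ.Realize v xs) ∧
      Guard F (K.eval N) N (assignment D v xs) (¬ φ.Realize v xs)

/-- The language has no function symbols, so a term is a variable. -/
theorem exists_var_of_term {n k D : ℕ} (hD : k ≤ D) (t : arith.Term (Fin n ⊕ Fin k)) :
    ∃ x : Var n D, x ≠ .acc ∧ x ≠ .aux ∧ x ≠ .tmp ∧
      ∀ (N : ℕ) (v : Fin n → Segment N) (xs : Fin k → Segment N),
        assignment D v xs x = (t.realize (Sum.elim v xs)).1 ∧ assignment D v xs x ≤ N := by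
  suffices h : ∃ x : Var n D, x ≠ .acc ∧ x ≠ .aux ∧ x ≠ .tmp ∧
      ∀ (N : ℕ) (v : Fin n → Segment N) (xs : Fin k → Segment N),
        assignment D v xs x = (t.realize (Sum.elim v xs)).1 by
    obtain ⟨x, h₁, h₂, h₃, h⟩ := h
    exact ⟨x, h₁, h₂, h₃, fun N v xs =>
      ⟨h N v xs, (h N v xs).trans_le (t.realize (Sum.elim v xs)).2⟩⟩
  cases t with
  | var s =>
    cases s with
    | inl i => exact ⟨.input i, by simp, by simp, by simp, fun N v xs => rfl⟩
    | inr i =>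
      refine ⟨.val ⟨i, by omega⟩, by simp, by simp, by simp, fun N v xs => ?_⟩
      simp [assignment, valuation, extendZero]
  | func f _ => exact Empty.elim f

theorem guarded_of_computes {n k : ℕ} {φ : arith.BoundedFormula (Fin n) k}
    (h : ∀ D ≥ k, ∃ (P : Prog (TestOp (Var n D))) (K : Polynomial ℕ) (x : Var n D),
      x ≠ .acc ∧ x ≠ .tmp ∧ ∀ (N : ℕ) (v : Fin n → Segment N) (xs : Fin k → Segment N),
        assignment D v xs x ≤ N ∧ ∃ val, Computes P (K.eval N) N (assignment D v xs) .acc val ∧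
          (val = assignment D v xs x ↔ φ.Realize v xs)) : Guarded φ := by
  refine ⟨k, fun D hD => ?_⟩
  obtain ⟨P, K, x, hxa, hxt, h⟩ := h D hD
  refine ⟨.seq P (eqTest .acc x .tmp), .seq P (neTest .acc x .tmp), K + 3, fun N v xs => ?_⟩
  obtain ⟨hx, val, hP, hval⟩ := h N v xs
  have hK : (K + 3).eval N = K.eval N + 3 := by simp
  rw [hK]
  exact ⟨(hP.guard_eq hxa hxt (by simp) rfl rfl hx).congr hval,
    (hP.guard_ne hxa hxt (by simp) rfl rfl hx).congr (not_congr hval)⟩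

theorem guarded_equal {n k : ℕ} (t₁ t₂ : arith.Term (Fin n ⊕ Fin k)) :
    Guarded (BoundedFormula.equal t₁ t₂) := by
  refine guarded_of_computes fun D hD => ?_
  obtain ⟨x, hx₁, hx₂, hx₃, hx⟩ := exists_var_of_term hD t₁
  obtain ⟨y, hy₁, hy₂, hy₃, hy⟩ := exists_var_of_term hD t₂
  refine ⟨addTo x .acc .tmp, 2, y, hy₁, hy₃, fun N v xs => ⟨?_, assignment D v xs x, ?_, ?_⟩⟩
  · exact (hy N v xs).2
  · have := computes_addTo (g := assignment D v xs) hx₁ hx₃ (by simp) rfl rfl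
      (hx N v xs).2
    simpa using this
  · rw [(hx N v xs).1, (hy N v xs).1, ← Subtype.ext_iff]
    rfl

theorem guarded_rel {n k l : ℕ} (R : arith.Relations l)
    (ts : Fin l → arith.Term (Fin n ⊕ Fin k)) : Guarded (BoundedFormula.rel R ts) := by
  refine guarded_of_computes fun D hD => ?_
  cases R with
  | add =>
    obtain ⟨x, hx₁, hx₂, hx₃, hx⟩ := exists_var_of_term hD (ts 0)
    obtain ⟨y, hy₁, hy₂, hy₃, hy⟩ := exists_var_of_term hD (ts 1)
    obtain ⟨z, hz₁, hz₂, hz₃, hz⟩ := exists_var_of_term hD (ts 2)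
    refine ⟨.seq (addTo x .acc .tmp) (addTo y .acc .tmp), 4, z, hz₁, hz₃,
      fun N v xs => ⟨?_, assignment D v xs x + assignment D v xs y, ?_, ?_⟩⟩
    · exact (hz N v xs).2
    · have := computes_add (g := assignment D v xs) hx₁ hx₃ hy₁ hy₃ (by simp) rfl rfl
        (hx N v xs).2 (hy N v xs).2
      simpa using this
    · rw [(hx N v xs).1, (hy N v xs).1, (hz N v xs).1]
      rfl
  | mul =>
    obtain ⟨x, hx₁, hx₂, hx₃, hx⟩ := exists_var_of_term hD (ts 0)
    obtain ⟨y, hy₁, hy₂, hy₃, hy⟩ := exists_var_of_term hD (ts 1)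
    obtain ⟨z, hz₁, hz₂, hz₃, hz⟩ := exists_var_of_term hD (ts 2)
    refine ⟨mulTo x y .acc .aux .tmp, 2 * Polynomial.X + 3, z, hz₁, hz₃,
      fun N v xs => ⟨?_, assignment D v xs x * assignment D v xs y, ?_, ?_⟩⟩
    · exact (hz N v xs).2
    · have := computes_mul (g := assignment D v xs) hx₂ hx₃ hy₂ hy₁ hy₃ (by simp) (by simp)
        (by simp) rfl rfl rfl (hx N v xs).2
        (hy N v xs).2
      simpa using this
    · rw [(hx N v xs).1, (hy N v xs).1, (hz N v xs).1]
      rfl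

/-- A non-deterministic guard cannot be negated, so guards for `φ` and for its negation are built
together: an implication combines the negative guard of its premise with the positive one of its
conclusion, and dually. Requiring this for all large `D` lets subformulas share one set of
variables. -/
theorem guarded {n k : ℕ} (φ : arith.BoundedFormula (Fin n) k) : Guarded φ := by
  induction φ with
  | falsum =>
    refine ⟨0, fun D _ => ⟨.seq (zero Var.tmp) (decr Var.tmp), .skip, 0, fun N v xs => ?_⟩⟩
    rw [Polynomial.eval_zero]
    exact ⟨Guard.fail Var.tmp N _, (Guard.skip N _).congr (by simp [BoundedFormula.Realize])⟩
  | equal t₁ t₂ => exact guarded_equal t₁ t₂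
  | rel R ts => exact guarded_rel R ts
  | imp φ ψ ihφ ihψ =>
    obtain ⟨D₁, h₁⟩ := ihφ
    obtain ⟨D₂, h₂⟩ := ihψ
    refine ⟨max D₁ D₂, fun D hD => ?_⟩
    obtain ⟨T₁, F₁, K₁, h₁⟩ := h₁ D (le_of_max_le_left hD)
    obtain ⟨T₂, F₂, K₂, h₂⟩ := h₂ D (le_of_max_le_right hD)
    refine ⟨.choice F₁ T₂, .seq T₁ F₂, K₁ + K₂, fun N v xs => ?_⟩
    rw [Polynomial.eval_add]
    exact ⟨((h₁ N v xs).2.choice (h₂ N v xs).1).congr (by rw [BoundedFormula.realize_imp]; tauto),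
      ((h₁ N v xs).1.seq (h₂ N v xs).2).congr (by rw [BoundedFormula.realize_imp]; tauto)⟩
  | @all k φ ih =>
    obtain ⟨D₀, h⟩ := ih
    refine ⟨max D₀ (k + 1), fun D hD => ?_⟩
    have hk : k < D := le_of_max_le_right hD
    obtain ⟨T, F, K, h⟩ := h D (le_of_max_le_left hD)
    refine ⟨forallProg (.val ⟨k, hk⟩) (.gap ⟨k, hk⟩) T,
      existsProg (.val ⟨k, hk⟩) (.gap ⟨k, hk⟩) F, Polynomial.X * K + K + 2, fun N v xs => ?_⟩
    have hK : (Polynomial.X * K + K + 2).eval N = N * K.eval N + K.eval N + 2 := by simp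
    rw [hK]
    have hT := guard_forall (N := N) (K := K.eval N) (g := assignment D v xs) (P := T)
      (x := .val ⟨k, hk⟩) (u := .gap ⟨k, hk⟩) (by simp)
      -- The predicate must make sense for every natural number, so the bound goes inside it:
      -- universally here, existentially in the dual case.
      (p := fun a => ∀ ha : a ≤ N, φ.Realize v (Fin.snoc xs (⟨a, ha⟩ : Segment N)))
      fun a ha => by
        have := (h N v (Fin.snoc xs (⟨a, ha⟩ : Segment N))).1
        rw [← setPair_assignment hk] at this
        exact this.congr ⟨fun h _ => h, fun h => h ha⟩
    have hF := guard_exists (N := N) (K := K.eval N) (g := assignment D v xs) (P := F)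
      (x := .val ⟨k, hk⟩) (u := .gap ⟨k, hk⟩) (by simp)
      (p := fun a => ∃ ha : a ≤ N, ¬ φ.Realize v (Fin.snoc xs (⟨a, ha⟩ : Segment N)))
      fun a ha => by
        have := (h N v (Fin.snoc xs (⟨a, ha⟩ : Segment N))).2
        rw [← setPair_assignment hk] at this
        exact this.congr ⟨fun h => ⟨ha, h⟩, fun ⟨_, h⟩ => h⟩
    rw [setPair_assignment_zero] at hT hF
    refine ⟨hT.congr ?_, (hF.mono (by omega)).congr ?_⟩
    · rw [BoundedFormula.realize_all]
      exact ⟨fun h a => h a.1 a.2 a.2, fun h a ha _ => h ⟨a, ha⟩⟩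
    · rw [BoundedFormula.realize_all, not_forall]
      exact ⟨fun ⟨a, _, ha, h⟩ => ⟨⟨a, ha⟩, h⟩, fun ⟨a, h⟩ => ⟨a.1, a.2, a.2, h⟩⟩

/-- The inputs are compared with the bound by a guard. -/
theorem exists_guard_inputs (n D : ℕ) (l : List (Fin n)) :
    ∃ (P : Prog (TestOp (Var n D))) (K : ℕ), ∀ (N : ℕ) (v : Fin n → ℕ),
      Guard P K N (valuation N v 0) (∀ i ∈ l, v i ≤ N) := by
  induction l with
  | nil => exact ⟨.skip, 0, fun N v => (Guard.skip N _).congr (by simp)⟩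
  | cons i l ih =>
    obtain ⟨P, K, h⟩ := ih
    refine ⟨.seq (leTest (.input i) .bound .tmp) P, 2 + K, fun N v => ?_⟩
    have := guard_le (N := N) (g := valuation (D := D) N v 0) (x := .input i) (y := .bound)
      (s := .tmp) (by simp) (by simp) (by simp) rfl le_rfl
    exact (this.seq (h N v)).congr (by simp [valuation])

theorem arithReduces_formulaLanguage {n : ℕ} (Φ : arith.Formula (Fin n)) :
    ∃ d : ℕ, 0 < d ∧ ∃ C : CounterProgram d, ArithReduces (formulaLanguage Φ) C.language := by
  obtain ⟨D, h⟩ := guarded Φ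
  obtain ⟨T, F, K, h⟩ := h D le_rfl
  obtain ⟨P, K', hP⟩ := exists_guard_inputs n D (List.finRange n)
  let a : Var n D → MvPolynomial (Fin (n + 1)) ℕ
    | .input i => .X i.succ
    | .gap _ => .X 0
    | .bound => .X 0
    | .pad => .X 0 * .X 0 + 2 * .X 0
    | _ => 0
  have ha : ∀ m : Fin (n + 1) → ℕ, (fun i => (a i).eval m) =
      valuation (m 0) (fun i => m i.succ) 0 := by
    intro m
    funext x
    cases x <;> simp [a, valuation]
  have hv : ∀ (m : Fin (n + 1) → ℕ) (hm : ∀ i : Fin n, m i.succ ≤ m 0),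
      valuation (m 0) (fun i => m i.succ) 0 = assignment D
        (fun i : Fin n => (⟨m i.succ, hm i⟩ : Segment (m 0))) (default : Fin 0 → _) := by
    intro m hm
    rw [assignment]
    congr 1
  -- `P` first checks that the inputs are at most `N`; only then do they form an assignment in
  -- `Segment N` on which `T` can be analysed. `.tmp` is `0` at the end and serves for the idle
  -- tests.
  refine arithReduces_of_program _ (.seq P T) .tmp a
    (.C K' + Polynomial.aeval (.X 0) K) (fun m g hg => ?_) (fun m hm => ?_)
  · rw [ha] at hg
    obtain ⟨u, hu, hg⟩ := run_seq.1 hg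
    obtain ⟨rfl, hm⟩ := (hP _ _).2 u hu
    have hm : ∀ i : Fin n, m i.succ ≤ m 0 := fun i => hm i (List.mem_finRange i)
    rw [hv m hm] at hg
    exact ⟨hm, ((h _ _ _).1.2 g hg).2⟩
  · obtain ⟨hm, hΦ⟩ := hm
    -- The bound of the simulation is the sum of the initial values, and `pad` alone contributes the
    -- required room.
    have hB : m 0 * m 0 + 2 * m 0 ≤ ∑ i, (a i).eval m := by
      have := Finset.single_le_sum (f := fun i => (a i).eval m) (fun _ _ => Nat.zero_le _)
        (Finset.mem_univ Var.pad)
      simpa [a] using this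
    have hK : MvPolynomial.eval m (.C K' + Polynomial.aeval (.X 0) K) =
        K' + K.eval (m 0) := by
      rw [map_add, MvPolynomial.eval_C, Polynomial.aeval_def, Polynomial.hom_eval₂,
        MvPolynomial.eval_X, Polynomial.eval, Subsingleton.elim (RingHom.comp _ _) (RingHom.id ℕ)]
    generalize (∑ i, (a i).eval m) = B at hB
    rw [hK, ha]
    refine ⟨valuation (m 0) (fun i => m i.succ) 0, rfl, ((hP _ _).1 (fun i _ => hm i) _ hB).seq ?_⟩
    rw [hv m hm]
    exact (h _ _ _).1.1 hΦ _ hB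

/-! ### Primes and square-free numbers -/

/-- If `(m, m) ∈ 𝓛_Φ` characterizes the elements `m` of a set of numbers, then the set reduces
to the language of a vector addition system. -/
theorem exists_vass_of_formula (Φ : arith.Formula (Fin 1)) (p : ℕ → Prop)
    (h : ∀ m, Φ.Realize (fun _ => (⟨m, le_rfl⟩ : Segment m)) ↔ p m) :
    ∃ d : ℕ, 0 < d ∧ ∃ A : VASS d, ArithReduces {m : Fin 1 → ℕ | p (m 0)} A.language := by
  obtain ⟨d, hd, C, q, hq⟩ := arithReduces_formulaLanguage Φ
  -- Identifying the two variables substitutes `(m, m)` for `(N, x₁)`.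
  refine ⟨d, hd, C.toVASS, fun i => MvPolynomial.rename (fun _ => 0) (q i), fun m => ?_⟩
  have := hq (m ∘ fun _ => 0)
  simp only [MvPolynomial.eval_rename, C.language_toVASS, ← this, Set.mem_ofPred_eq, ← h]
  exact ⟨fun h => ⟨fun _ => le_rfl, h⟩, fun ⟨_, h⟩ => h⟩

/-- The atomic formula `t₁ + t₂ = t₃`. -/
abbrev addFormula {k : ℕ} (t₁ t₂ t₃ : arith.Term (Fin 1 ⊕ Fin k)) :
    arith.BoundedFormula (Fin 1) k :=
  .rel (ArithRel.add : arith.Relations 3) ![t₁, t₂, t₃]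

/-- The atomic formula `t₁ * t₂ = t₃`. -/
abbrev mulFormula {k : ℕ} (t₁ t₂ t₃ : arith.Term (Fin 1 ⊕ Fin k)) :
    arith.BoundedFormula (Fin 1) k :=
  .rel (ArithRel.mul : arith.Relations 3) ![t₁, t₂, t₃]

/-- The free variable. -/
abbrev freeVar {k : ℕ} : arith.Term (Fin 1 ⊕ Fin k) := .var (.inl 0)

/-- A bound variable. -/
abbrev boundVar {k : ℕ} (i : Fin k) : arith.Term (Fin 1 ⊕ Fin k) := .var (.inr i)

theorem realize_addFormula {k N : ℕ} (t₁ t₂ t₃ : arith.Term (Fin 1 ⊕ Fin k))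
    (v : Fin 1 → Segment N) (xs : Fin k → Segment N) : (addFormula t₁ t₂ t₃).Realize v xs ↔
      (t₁.realize (Sum.elim v xs)).1 + (t₂.realize (Sum.elim v xs)).1 =
        (t₃.realize (Sum.elim v xs)).1 := Iff.rfl

theorem realize_mulFormula {k N : ℕ} (t₁ t₂ t₃ : arith.Term (Fin 1 ⊕ Fin k))
    (v : Fin 1 → Segment N) (xs : Fin k → Segment N) : (mulFormula t₁ t₂ t₃).Realize v xs ↔
      (t₁.realize (Sum.elim v xs)).1 * (t₂.realize (Sum.elim v xs)).1 =
        (t₃.realize (Sum.elim v xs)).1 := Iff.rfl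

/-- Defines `1` without constants. For `N = 0` the condition holds for every `a`, so the formulas
below are checked at `m = 0` separately. -/
theorem forall_mul_eq_self_iff {N a : ℕ} (hN : 0 < N) : (∀ z ≤ N, a * z = z) ↔ a = 1 :=
  ⟨fun h => by simpa using h 1 hN, by rintro rfl; simp⟩

/-- The number is neither `0` nor `1`, and one of any two factors is a unit. -/
def primeFormula : arith.Formula (Fin 1) :=
  (BoundedFormula.all (mulFormula freeVar (boundVar 0) (boundVar 0))).not ⊓
    BoundedFormula.all (BoundedFormula.all ((mulFormula (boundVar 0) (boundVar 1) freeVar).imp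
      ((BoundedFormula.all (mulFormula (boundVar 0) (boundVar 2) (boundVar 2))) ⊔
        (BoundedFormula.all (mulFormula (boundVar 1) (boundVar 2) (boundVar 2))))))

/-- The number is not `0`, and every factor whose square divides it is a unit. -/
def squarefreeFormula : arith.Formula (Fin 1) :=
  (addFormula freeVar freeVar freeVar).not ⊓
    BoundedFormula.all (BoundedFormula.all (BoundedFormula.all
      ((mulFormula (boundVar 0) (boundVar 0) (boundVar 1)).imp
        ((mulFormula (boundVar 1) (boundVar 2) freeVar).imp
          (BoundedFormula.all (mulFormula (boundVar 0) (boundVar 3) (boundVar 3)))))))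

theorem realize_primeFormula (m : ℕ) :
    primeFormula.Realize (fun _ => (⟨m, le_rfl⟩ : Segment m)) ↔ m.Prime := by
  have key : primeFormula.Realize (fun _ => (⟨m, le_rfl⟩ : Segment m)) ↔
      (¬ ∀ z ≤ m, m * z = z) ∧ ∀ a ≤ m, ∀ b ≤ m, a * b = m →
        (∀ z ≤ m, a * z = z) ∨ ∀ z ≤ m, b * z = z := by
    simp only [primeFormula, Formula.Realize, BoundedFormula.realize_inf,
      BoundedFormula.realize_not, BoundedFormula.realize_all, BoundedFormula.realize_imp,
      BoundedFormula.realize_sup, realize_mulFormula, Term.realize_var, Sum.elim_inl,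
      Sum.elim_inr, Subtype.forall]
    simp [Fin.snoc]
  rw [key]
  rcases Nat.eq_zero_or_pos m with rfl | hm
  · simp [Nat.not_prime_zero]
  simp only [forall_mul_eq_self_iff hm]
  change _ ↔ Irreducible m
  rw [irreducible_iff, Nat.isUnit_iff]
  refine and_congr_right fun _ => ⟨fun h a b hab => ?_, fun h a _ b _ hab => ?_⟩
  -- Factors of a positive `m` are at most `m`, so quantifiers over `{0, …, m}` see all of them.
  · simpa using h a (Nat.le_of_dvd hm ⟨b, hab⟩) b (Nat.le_of_dvd hm ⟨a, hab.trans (mul_comm a b)⟩)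
      hab.symm
  · simpa using h hab.symm

theorem realize_squarefreeFormula (m : ℕ) :
    squarefreeFormula.Realize (fun _ => (⟨m, le_rfl⟩ : Segment m)) ↔ Squarefree m := by
  have key : squarefreeFormula.Realize (fun _ => (⟨m, le_rfl⟩ : Segment m)) ↔
      ¬ m = 0 ∧ ∀ a ≤ m, ∀ b ≤ m, ∀ c ≤ m, a * a = b → b * c = m → ∀ z ≤ m, a * z = z := by
    simp only [squarefreeFormula, Formula.Realize, BoundedFormula.realize_inf,
      BoundedFormula.realize_not, BoundedFormula.realize_all, BoundedFormula.realize_imp,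
      realize_mulFormula, realize_addFormula, Term.realize_var, Sum.elim_inl, Sum.elim_inr,
      Subtype.forall]
    simp [Fin.snoc]
  rw [key]
  rcases Nat.eq_zero_or_pos m with rfl | hm
  · simp
  simp only [forall_mul_eq_self_iff hm]
  refine ⟨fun h a ha => ?_, fun h => ⟨hm.ne', ?_⟩⟩
  · obtain ⟨c, hc⟩ := ha
    rw [Nat.isUnit_iff]
    -- In `m = a * a * c`, the numbers `a`, `a * a` and `c` all divide `m` and so lie in the
    -- segment.
    exact h.2 a (Nat.le_of_dvd hm ⟨a * c, by rw [hc, mul_assoc]⟩) (a * a)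
      (Nat.le_of_dvd hm ⟨c, hc⟩) c (Nat.le_of_dvd hm ⟨a * a, by rw [hc, mul_comm]⟩) rfl hc.symm
  · rintro a - _ - c - rfl hc
    exact Nat.isUnit_iff.1 (h a ⟨c, hc.symm⟩)

end FixedVASS

theorem mainTheorem1 :
    (∀ (n : ℕ) (Φ : FixedVASS.arith.Formula (Fin n)),
      (∃ d : ℕ, 0 < d ∧ ∃ C : FixedVASS.CounterProgram d,
        FixedVASS.ArithReduces (FixedVASS.formulaLanguage Φ) C.language) ∧
      (∃ d : ℕ, 0 < d ∧ ∃ A : FixedVASS.VASS d,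
        FixedVASS.ArithReduces (FixedVASS.formulaLanguage Φ) A.language)) ∧
    (∃ d : ℕ, 0 < d ∧ ∃ A : FixedVASS.VASS d,
      FixedVASS.ArithReduces {m : Fin 1 → ℕ | Nat.Prime (m 0)} A.language) ∧
    (∃ d : ℕ, 0 < d ∧ ∃ A : FixedVASS.VASS d,
      FixedVASS.ArithReduces {m : Fin 1 → ℕ | Squarefree (m 0)} A.language) := by
  refine ⟨fun n Φ => ?_, FixedVASS.exists_vass_of_formula _ _ FixedVASS.realize_primeFormula,
    FixedVASS.exists_vass_of_formula _ _ FixedVASS.realize_squarefreeFormula⟩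
  have h := FixedVASS.arithReduces_formulaLanguage Φ
  obtain ⟨d, hd, C, hC⟩ := h
  exact ⟨⟨d, hd, C, hC⟩, d, hd, C.toVASS, C.language_toVASS.symm ▸ hC⟩
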